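/- **Definitions.** Let $(X,|\cdot\,\cdot|)$ be a compact metric space; give $X^2=X\times X$ the maximum metric, let $\Delta\subset X^2$ be the diagonal, and for $z=(x,y)\in X^2$ put $|z|=|xy|$. A *spectral geometry* $M=\{\mathcal A,\mathcal H,ds\}$ on $X$ consists of a complex Hilbert space $\mathcal H$, an involutive (unital) representation $\pi$ on $\mathcal H$ of the algebra $\mathcal A$ of complex-valued Lipschitz functions on $X$, and an injective compact self-adjoint operator $ds$ on $\mathcal H$ such that: (i) $\pi$ is the restriction to $\mathcal A$ of an involutive (unital) representation $\widetilde\pi$ of $C(X^2)$ on $\mathcal H$, where $a\in\mathcal A$ is regarded as the function $(x,x')\mapsto a(x)$; let $P$ be the spectral (projection-valued Borel) measure on $X^2$ with $\widetilde\pi(a)=\int_{X^2}a\,dP$ for all $a\in C(X^2)$; (ii) $ds\circ P(A)=P(\gamma(A))\circ ds$ for every Borel set $A\subset X^2$, where $\gamma(x,x')=(x',x)$; (iii) for every eigenvalue $\lambda$ of $ds$, if $L_\lambda$ is the eigenspace of $ds^2$ for $\lambda^2$ and $A_\lambda$ is the union of all open $A\subset X^2$ such that $P(A)$ projects onto a subspace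 orthogonal to $L_\lambda$, then $P(A_\lambda)$ is the orthogonal projector onto $L_\lambda^\perp$; (iv) $|yy'|=|\lambda|$ for every eigenvalue $\lambda$ of $ds$ and every $(y,y')\in\Lambda_\lambda:=X^2\setminus A_\lambda$. The *support* of $M$ is $B=\bigcup_\lambda\Lambda_\lambda$ ($\lambda$ running over the eigenvalues of $ds$), and its *local density* is $$\operatorname{dens}_{\operatorname{loc}}(M)=\lim_{t\to0+}\ \inf_{\substack{z\in X^2\setminus\Delta\\ |z|\le t}}\ \sup_{b\in B}\frac{|z|}{|zb|}\in[0,\infty]$$ (with $|z|/0=\infty$, $\inf\emptyset=\infty$). Let $\omega$ be a generalized limit as used for Dixmier traces: a positive linear functional on the bounded real sequences which equals the limit on convergent sequences and is invariant under $(a_0,a_1,\dots)\mapsto(a_0,a_0,a_1,a_1,\dots)$. For $p\ge0$ let $\operatorname{Tr}_\omega(|ds|^p)\in[0,\infty]$ be the $\omega$-limit of the sequence $\bigl(\frac1{\log N}\sum_{i<N}\mu_i^p\bigr)_{N\ge2}$, where $\mu_0\ge\mu_1\ge\dots$ are the eigenvalues of $|ds|$ counted with multiplicity (missing terms contribute $0$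 if $\mathcal H$ is finite-dimensional), and $\operatorname{Tr}_\omega(|ds|^p)=\infty$ if this sequence is unbounded. The *dimension* of $M$ is $$\dim M=\sup\{p\ge0:\operatorname{Tr}_\omega(|ds|^p)=\infty\}=\inf\{p\ge0:\operatorname{Tr}_\omega(|ds|^p)=0\}\in[0,\infty]$$ (with $\sup\emptyset=0$, $\inf\emptyset=\infty$), and the *spectral dimension* of $X$ is $$\dim_S(X)=\liminf_{\operatorname{dens}_{\operatorname{loc}}(M)\to\infty}\dim M=\sup_{D<\infty}\ \inf\{\dim M:\ \operatorname{dens}_{\operatorname{loc}}(M)>D\},$$ $M$ running over all spectral geometries on $X$ (those of infinite local density included). **Statement.** Let $X$ be a compact (non-empty, connected, smooth, without boundary) Riemannian manifold of dimension $n$, regarded as a compact metric space with its Riemannian distance. Then there is a spectral geometry $M$ on $X$ with $\operatorname{dens}_{\operatorname{loc}}(M)=\infty$ such that, for every $\omega$ as above, $\dim M=n$ (both expressions for $\dim M$ equal $n$). In particular, for every such $\omega$, $\dim_S(X)=n=\dim X$. -/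

import Mathlib

open Set Filter Topology MeasureTheory
open scoped NNReal ENNReal ContDiff Manifold Bundle InnerProductSpace BoundedContinuousFunction

noncomputable section

universe u

/-! ### Lipschitz functions and spectral measures -/

/-- The involutive algebra of complex-valued Lipschitz functions on a compact metric space. -/
def lipschitzAlgebra (X : Type u) [MetricSpace X] [CompactSpace X] :
    StarSubalgebra ℂ C(X, ℂ) where
  carrier := {a | ∃ K : ℝ≥0, LipschitzWith K a}
  mul_mem' := by
    rintro a b ⟨K, hK⟩ ⟨L, hL⟩
    refine ⟨‖a‖₊ * L + K * ‖b‖₊, LipschitzWith.of_dist_le_mul fun x y => ?_⟩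
    have h1 : dist (a x * b x) (a y * b y) ≤ ‖a x‖ * dist (b x) (b y) + dist (a x) (a y) * ‖b y‖ := by
      simp only [dist_eq_norm]
      have h : a x * b x - a y * b y = a x * (b x - b y) + (a x - a y) * b y := by ring
      rw [h, ← norm_mul, ← norm_mul]
      exact norm_add_le _ _
    have h2 : ‖a x‖ * dist (b x) (b y) ≤ ‖a‖ * (L * dist x y) :=
      mul_le_mul (a.norm_coe_le_norm x) (hL.dist_le_mul x y) dist_nonneg (norm_nonneg _)
    have h3 : dist (a x) (a y) * ‖b y‖ ≤ (K * dist x y) * ‖b‖ :=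
      mul_le_mul (hK.dist_le_mul x y) (b.norm_coe_le_norm y) (norm_nonneg _) (by positivity)
    simp only [ContinuousMap.coe_mul, Pi.mul_apply, NNReal.coe_add, NNReal.coe_mul, coe_nnnorm]
    linarith
  add_mem' := by
    rintro a b ⟨K, hK⟩ ⟨L, hL⟩
    exact ⟨K + L, hK.add hL⟩
  algebraMap_mem' := fun r => ⟨0, LipschitzWith.const r⟩
  star_mem' := by
    rintro a ⟨K, hK⟩
    refine ⟨K, LipschitzWith.of_dist_le_mul fun x y => ?_⟩
    simpa [dist_eq_norm, ← map_sub] using hK.dist_le_mul x y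

/-- A function `a` on `X`, viewed as the function `(x, x') ↦ a x` on `X²`. -/
def pullbackFst {X : Type u} [TopologicalSpace X] (a : C(X, ℂ)) : C(X × X, ℂ) :=
  a.comp ⟨Prod.fst, continuous_fst⟩

/-- A spectral (projection-valued) Borel measure on `T`: for every Borel set `A`, `proj A` is an
orthogonal projector, and `A ↦ ⟪proj A ξ, ξ⟫` is a Borel measure for every vector `ξ` (only the
values `proj A` at Borel sets `A` are meaningful). -/
structure SpectralMeasure (T : Type*) [TopologicalSpace T] (H : Type*) [NormedAddCommGroup H]
    [InnerProductSpace ℂ H] [CompleteSpace H] where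
  proj : Set T → H →L[ℂ] H
  isStarProjection_proj : ∀ A, MeasurableSet[borel T] A → IsStarProjection (proj A)
  measure : H → @Measure T (borel T)
  measure_apply : ∀ ξ A, MeasurableSet[borel T] A →
    measure ξ A = ENNReal.ofReal (RCLike.re ⟪proj A ξ, ξ⟫_ℂ)

/-- `ρ(a) = ∫ a dP` for every continuous function `a`, in the weak sense. -/
def SpectralMeasure.Represents {T : Type*} [TopologicalSpace T] [CompactSpace T]
    {H : Type*} [NormedAddCommGroup H] [InnerProductSpace ℂ H] [CompleteSpace H]
    (P : SpectralMeasure T H) (ρ : C(T, ℂ) →⋆ₐ[ℂ] (H →L[ℂ] H)) : Prop :=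
  ∀ (a : C(T, ℂ)) (ξ : H), ⟪ξ, ρ a ξ⟫_ℂ = ∫ z, a z ∂(P.measure ξ)

/-! ### Spectral geometries -/

section

variable {H : Type*} [NormedAddCommGroup H] [InnerProductSpace ℂ H]

/-- The eigenspace `L_lam` of `T²` for the eigenvalue `lam²`. -/
def sqEigenspace (T : H →L[ℂ] H) (lam : ℂ) : Submodule ℂ H :=
  Module.End.eigenspace ((T ∘L T : H →L[ℂ] H) : Module.End ℂ H) (lam ^ 2)

/-- The union `A_lam` of all open sets `A` such that `P(A)` projects onto a subspace orthogonal
to `L_lam`. -/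
def spectralNullSet {T : Type*} [TopologicalSpace T] [CompleteSpace H]
    (P : SpectralMeasure T H) (ds : H →L[ℂ] H) (lam : ℂ) : Set T :=
  ⋃₀ {A | IsOpen A ∧ (LinearMap.range (P.proj A : H →ₗ[ℂ] H)) ⟂ sqEigenspace ds lam}

end

/-- A spectral geometry on a compact metric space `X`. -/
structure SpectralGeometry (X : Type u) [MetricSpace X] [CompactSpace X] where
  /-- the Hilbert space -/
  H : Type u
  [normedAddCommGroup : NormedAddCommGroup H]
  [innerProductSpace : InnerProductSpace ℂ H]
  [completeSpace : CompleteSpace H]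
  /-- the representation of the algebra of Lipschitz functions -/
  rep : lipschitzAlgebra X →⋆ₐ[ℂ] (H →L[ℂ] H)
  /-- the unit length operator -/
  ds : H →L[ℂ] H
  injective_ds : Function.Injective ds
  isCompactOperator_ds : IsCompactOperator ds
  isSelfAdjoint_ds : IsSelfAdjoint ds
  /-- the extended representation of `C(X²)` -/
  extRep : C(X × X, ℂ) →⋆ₐ[ℂ] (H →L[ℂ] H)
  /-- axiom (i) -/
  rep_eq : ∀ a : lipschitzAlgebra X, rep a = extRep (pullbackFst (a : C(X, ℂ)))
  /-- the Borel spectral measure on `X²` of the extended representation -/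
  P : SpectralMeasure (X × X) H
  represents : P.Represents extRep
  /-- axiom (ii) -/
  ds_comp_proj : ∀ A : Set (X × X), MeasurableSet[borel (X × X)] A →
    ds ∘L P.proj A = P.proj (Prod.swap '' A) ∘L ds
  /-- axiom (iii) -/
  range_proj : ∀ lam : ℂ, Module.End.HasEigenvalue (ds : Module.End ℂ H) lam →
    LinearMap.range (P.proj (spectralNullSet P ds lam) :
      H →ₗ[ℂ] H) = (sqEigenspace ds lam)ᗮ
  /-- axiom (iv) -/
  dist_eq : ∀ lam : ℂ, Module.End.HasEigenvalue (ds : Module.End ℂ H) lam →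
    ∀ z : X × X, z ∉ spectralNullSet P ds lam →
      dist z.1 z.2 = ‖lam‖

namespace SpectralGeometry

attribute [instance] normedAddCommGroup innerProductSpace completeSpace

variable {X : Type u} [MetricSpace X] [CompactSpace X]

/-- The support `B = ⋃ Λ_lam`, where `lam` runs over the eigenvalues of `ds` and `Λ_lam` is the
complement of `A_lam`. -/
def support (M : SpectralGeometry X) : Set (X × X) :=
  ⋃ (lam : ℂ) (_ : Module.End.HasEigenvalue (M.ds : Module.End ℂ M.H) lam),
    (spectralNullSet M.P M.ds lam)ᶜ

end SpectralGeometry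

/-! ### Local density -/

section

variable {X : Type u} [MetricSpace X]

/-- The density of `B ⊆ X²` in the neighbourhood `U_t = {z : |z| ≤ t}` of the diagonal: the
infimum over `z ∈ U_t ∖ Δ` of `sup_{b ∈ B} |z| / |zb|`, where `|z|` is the distance between the
coordinates of `z` and `X²` carries the maximum metric (the quotient is `∞` for `b = z`). -/
def densityNear (B : Set (X × X)) (t : ℝ) : ℝ≥0∞ :=
  ⨅ z ∈ {z : X × X | z.1 ≠ z.2 ∧ dist z.1 z.2 ≤ t}, ⨆ b ∈ B, edist z.1 z.2 / edist z b

/-- The limit of `densityNear B t` as `t → 0`, `t > 0`, which is a supremum by monotonicity. -/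
def localDensity (B : Set (X × X)) : ℝ≥0∞ :=
  ⨆ t ∈ Ioi (0 : ℝ), densityNear B t

theorem densityNear_antitone (B : Set (X × X)) : Antitone (densityNear B) :=
  fun _ _ hst => biInf_mono fun _ hz => ⟨hz.1, hz.2.trans hst⟩

theorem tendsto_densityNear (B : Set (X × X)) :
    Tendsto (densityNear B) (𝓝[>] 0) (𝓝 (localDensity B)) := by
  have h := (densityNear_antitone B).tendsto_nhdsGT 0
  rwa [sSup_image] at h

end

/-! ### Dixmier trace and dimension -/

/-- A generalized limit defining a Dixmier trace: a positive linear functional on bounded real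
sequences that extends the limit of convergent sequences and is invariant under
`(a₀, a₁, …) ↦ (a₀, a₀, a₁, a₁, …)`. -/
structure DixmierLimit where
  toLinearMap : (ℕ →ᵇ ℝ) →ₗ[ℝ] ℝ
  nonneg : ∀ a : ℕ →ᵇ ℝ, (∀ n, 0 ≤ a n) → 0 ≤ toLinearMap a
  eq_of_tendsto : ∀ (a : ℕ →ᵇ ℝ) (l : ℝ), Tendsto a atTop (𝓝 l) → toLinearMap a = l
  scale_invariant : ∀ a : ℕ →ᵇ ℝ,
    toLinearMap (a.compContinuous ⟨fun n => n / 2, continuous_of_discreteTopology⟩) = toLinearMap a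

/-- Such generalized limits exist. -/
theorem DixmierLimit.nonempty : Nonempty DixmierLimit := by
  classical
  let U : Ultrafilter ℕ := Filter.hyperfilter ℕ
  have hU : (U : Filter ℕ) ≤ atTop := by
    rw [← Nat.cofinite_eq_atTop]; exact Filter.hyperfilter_le_cofinite
  have key : ∀ (f : ℕ → ℝ) (C : ℝ), (∀ n, |f n| ≤ C) → ∃ l, Tendsto f U (𝓝 l) := by
    intro f C hf
    have hc : IsCompact (Set.Icc (-C) C) := isCompact_Icc
    obtain ⟨l, -, hl⟩ := hc.ultrafilter_le_nhds (U.map f) (by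
      exact le_principal_iff.2 (Filter.mem_map.2
        (Filter.Eventually.of_forall (fun n : ℕ => abs_le.1 (hf n)))))
    exact ⟨l, hl⟩
  let D : ℕ → (ℕ →ᵇ ℝ) → ℕ → ℝ := fun j a n => a (n / 2 ^ j)
  have hb : ∀ (a : ℕ →ᵇ ℝ) n, |a n| ≤ ‖a‖ := fun a n => a.norm_coe_le_norm n
  have h1 : ∀ a : ℕ →ᵇ ℝ, ∀ j, ∃ l, Tendsto (D j a) U (𝓝 l) := fun a j => key _ ‖a‖ fun n => hb a _
  choose L hL using h1
  have hLb : ∀ a j, |L a j| ≤ ‖a‖ := fun a j =>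
    le_of_tendsto (hL a j).abs (Filter.Eventually.of_forall fun n => hb a _)
  let S : (ℕ →ᵇ ℝ) → ℕ → ℝ := fun a k => (∑ j ∈ Finset.range k, L a j) / k
  have hSb : ∀ a k, |S a k| ≤ ‖a‖ := by
    intro a k
    simp only [S, abs_div, Nat.abs_cast]
    apply div_le_of_le_mul₀ (by positivity) (by positivity)
    calc |∑ j ∈ Finset.range k, L a j| ≤ ∑ j ∈ Finset.range k, |L a j| := Finset.abs_sum_le_sum_abs _ _
      _ ≤ ∑ j ∈ Finset.range k, ‖a‖ := Finset.sum_le_sum fun j _ => hLb a j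
      _ = ‖a‖ * k := by simp [mul_comm]
  have h2 : ∀ a, ∃ l, Tendsto (S a) U (𝓝 l) := fun a => key _ ‖a‖ (hSb a)
  choose W hW using h2
  have Ladd : ∀ a b j, L (a + b) j = L a j + L b j := fun a b j =>
    tendsto_nhds_unique (hL (a + b) j) ((hL a j).add (hL b j))
  have Lsmul : ∀ (c : ℝ) a j, L (c • a) j = c * L a j := fun c a j =>
    tendsto_nhds_unique (hL (c • a) j) ((hL a j).const_mul c)
  refine ⟨⟨⟨⟨W, ?_⟩, ?_⟩, ?_, ?_, ?_⟩⟩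
  · intro a b
    refine tendsto_nhds_unique (hW (a + b)) (((hW a).add (hW b)).congr fun k => ?_)
    simp only [S, Ladd, Finset.sum_add_distrib, add_div]
  · intro c a
    refine tendsto_nhds_unique (hW (c • a)) (((hW a).const_mul c).congr fun k => ?_)
    simp only [S, Lsmul, ← Finset.mul_sum, mul_div_assoc]
  · intro a ha
    refine ge_of_tendsto (hW a) (Filter.Eventually.of_forall fun k => ?_)
    refine div_nonneg (Finset.sum_nonneg fun j _ => ?_) (by positivity)
    exact ge_of_tendsto (hL a j) (Filter.Eventually.of_forall fun n => ha _)
  · intro a l h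
    have hl : ∀ j, L a j = l := fun j => by
      refine tendsto_nhds_unique (hL a j) (Tendsto.mono_left ?_ hU)
      exact h.comp (Nat.tendsto_div_const_atTop (by positivity))
    refine tendsto_nhds_unique (hW a) (Tendsto.mono_left ?_ hU)
    refine tendsto_const_nhds.congr' ?_
    filter_upwards [eventually_gt_atTop 0] with k hk
    simp only [S, hl]
    simp
    field_simp
  · intro a
    set b := a.compContinuous ⟨fun n => n / 2, continuous_of_discreteTopology⟩ with hbdef
    have hLs : ∀ j, L b j = L a (j + 1) := fun j => by
      refine tendsto_nhds_unique (hL b j) ((hL a (j + 1)).congr fun n => ?_)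
      simp [D, hbdef, pow_succ, Nat.div_div_eq_div_mul]
    have hd : Tendsto (fun k => S b k - S a k) U (𝓝 0) := by
      refine Tendsto.mono_left ?_ hU
      have hz : Tendsto (fun k : ℕ => (2 * ‖a‖) / (k : ℝ)) atTop (𝓝 0) :=
        tendsto_const_div_atTop_nhds_zero_nat _
      refine squeeze_zero_norm (fun k => ?_) hz
      simp only [S, hLs, ← sub_div, Real.norm_eq_abs, abs_div, Nat.abs_cast]
      gcongr
      have h1 := Finset.sum_range_succ (L a) k
      have h2 := Finset.sum_range_succ' (L a) k
      have : ∑ x ∈ Finset.range k, L a (x + 1) - ∑ j ∈ Finset.range k, L a j = L a k - L a 0 := by linarith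
      rw [this]
      have := abs_sub (L a k) (L a 0)
      have := hLb a k
      have := hLb a 0
      linarith
    have := tendsto_nhds_unique hd ((hW b).sub (hW a))
    change W b = W a
    linarith

section

variable {H : Type*} [NormedAddCommGroup H] [InnerProductSpace ℂ H]

/-- For self-adjoint `T` and `t > 0`: the sum of the eigenspaces of `|T|` for eigenvalues `≥ t`
(for `s > 0`, the eigenspace of `|T|` for `s` is that of `T²` for `s²`). -/
def absEigenspaceGE (T : H →L[ℂ] H) (t : ℝ) : Submodule ℂ H :=
  ⨆ s ∈ Ici t, sqEigenspace T (s : ℂ)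

/-- For compact self-adjoint `T`: the nonincreasing sequence `μ₀ ≥ μ₁ ≥ …` of the positive
eigenvalues of `|T|`, counted with multiplicity and continued by `0` if there are finitely many. -/
def absEigenvalue (T : H →L[ℂ] H) (n : ℕ) : ℝ :=
  sSup {t : ℝ | 0 < t ∧ (n : Cardinal) < Module.rank ℂ (absEigenspaceGE T t)}

open scoped Classical in
/-- The sequence `σ_N(|T|^p) / log N`, `N = 2, 3, …`, where `σ_N(|T|^p) = ∑_{i < N} μ_i ^ p` is
the sum of the first `N` eigenvalues of `|T|^p`. -/
def dixmierSeq (T : H →L[ℂ] H) (p : ℝ≥0) (n : ℕ) : ℝ :=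
  (∑ i ∈ Finset.range (n + 2), if absEigenvalue T i = 0 then 0 else absEigenvalue T i ^ (p : ℝ)) /
    Real.log ((n : ℝ) + 2)

open scoped Classical in
/-- The Dixmier trace `Tr_φ(|T|^p)`; it is `∞` if `σ_N(|T|^p) / log N` is unbounded. -/
def dixmierTraceAbsPow (φ : DixmierLimit) (T : H →L[ℂ] H) (p : ℝ≥0) : ℝ≥0∞ :=
  if h : ∃ C : ℝ, ∀ m n, dist (dixmierSeq T p m) (dixmierSeq T p n) ≤ C then
    ENNReal.ofReal
      (φ.toLinearMap (BoundedContinuousFunction.mkOfDiscrete (dixmierSeq T p) h.choose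
        h.choose_spec))
  else ⊤

end

/-- The local density of a spectral geometry. -/
def SpectralGeometry.localDensity {X : Type u} [MetricSpace X] [CompactSpace X]
    (M : SpectralGeometry X) : ℝ≥0∞ :=
  _root_.localDensity M.support

/-- The dimension of a spectral geometry: `sup {p ≥ 0 : Tr_φ(|ds|^p) = ⊤}`, in `[0, ∞]`. -/
def SpectralGeometry.dim {X : Type u} [MetricSpace X] [CompactSpace X]
    (φ : DixmierLimit) (M : SpectralGeometry X) : ℝ≥0∞ :=
  ⨆ p ∈ {p : ℝ≥0 | dixmierTraceAbsPow φ M.ds p = ⊤}, (p : ℝ≥0∞)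

/-- The infimum `inf {p ≥ 0 : Tr_φ(|ds|^p) = 0}`, in `[0, ∞]`, the second expression for the
dimension. -/
def SpectralGeometry.dimInf {X : Type u} [MetricSpace X] [CompactSpace X]
    (φ : DixmierLimit) (M : SpectralGeometry X) : ℝ≥0∞ :=
  ⨅ p ∈ {p : ℝ≥0 | dixmierTraceAbsPow φ M.ds p = 0}, (p : ℝ≥0∞)

/-- The spectral dimension of `X`: the lower limit of `dim M` over all spectral geometries `M` on
`X` as the local density of `M` tends to `∞`. -/
def spectralDim (φ : DixmierLimit) (X : Type u) [MetricSpace X] [CompactSpace X] : ℝ≥0∞ :=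
  Filter.liminf (fun M : SpectralGeometry X => M.dim φ)
    (Filter.comap SpectralGeometry.localDensity (𝓝 ⊤))

end

/-! The only geometric input is that a compact Riemannian manifold is locally bi-Lipschitz to `ℝⁿ`.
Both halves then come from counting separated points, at the scale given by eigenvalues of `ds`.

Lower bound. For `n > 0`, a chart cube carries `mⁿ` pairs of points, each pair of length comparable
to `1/m`, with first points separated at that same scale. If the local density exceeds a fixed
constant, then for large `m` each pair has a support point of `M` so close to it that disjoint balls
around the pairs still contain these points. Axiom (iv) makes the corresponding eigenvalue at least
a multiple of `1/m` in absolute value. Axiom (iii) gives a nonzero vector of the eigenspace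
localized in the ball, and disjoint sets give orthogonal vectors. Hence `μ_i ≥ c/m` for `i < mⁿ`,
and `σ_N(|ds|^p)` with `N = mⁿ` is at least a constant times `m^(n-p)`, which outgrows `log N` when
`p < n` (`exists_forall_le_absEigenvalue`, `dixmierTraceAbsPow_eq_top`).

Upper bound. Take finite nets of mesh `2^(-k)/(k+1)` and let `S` be the set of pairs of distinct
points of the `k`-th net at distance at most `4·2^(-k)`, over all `k`. The factor `k+1` makes the
local density infinite, yet level `k` has only `O((k+1)^(2n) 2^(kn))` pairs, so the sum of `|s|^q`
over `S` converges for every `q > n` (`exists_localDensity_eq_top`). On `ℓ²(S)` the operator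
`e_(x,y) ↦ |xy| e_(y,x)`, with `C(X²)` acting by multiplication, is a spectral geometry whose
support contains `S`. The absolute values of its eigenvalues are the lengths of the pairs, so the
sum of `μ_i^p` converges for `p > n` and the Dixmier trace vanishes. -/

noncomputable section

/-! ### Charts of a Riemannian manifold are locally bi-Lipschitz -/

section RiemannianCharts

open Manifold Metric Bundle

variable {E : Type*} [NormedAddCommGroup E] [NormedSpace ℝ E] {H : Type*} [TopologicalSpace H]
  (I : ModelWithCorners ℝ E H) {M : Type*} [MetricSpace M] [ChartedSpace H M]
  [RiemannianBundle (fun (x : M) ↦ TangentSpace I x)]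
  [IsManifold I 1 M] [IsContinuousRiemannianBundle E (fun (x : M) ↦ TangentSpace I x)]
  [IsRiemannianManifold I M]

attribute [local instance] normedAddCommGroupTangentSpaceVectorSpace
attribute [local instance] normedSpaceTangentSpaceVectorSpace

/-- The inverse chart has bounded derivative near the base point, so a straight segment in the chart
pulls back to a path of length at most `C` times that of the segment. Convexity of the ball
intersected with `range I` keeps the segment where the bound holds. -/
theorem exists_nhds_edist_le_mul_edist_extChartAt (x : M) :
    ∃ C : ℝ≥0, ∃ s ∈ 𝓝 x, ∀ y ∈ s, ∀ z ∈ s,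
      edist y z ≤ C * edist (extChartAt I x y) (extChartAt I x z) := by
  rcases eventually_enorm_mfderivWithin_symm_extChartAt_lt I x with ⟨C, C_pos, hC⟩
  obtain ⟨S, hS, hSC⟩ := eventually_iff_exists_mem.1 hC
  obtain ⟨r, r_pos, hr⟩ : ∃ r > 0,
      ball (extChartAt I x x) r ∩ range I ⊆ (extChartAt I x).target ∩ S :=
    mem_nhdsWithin_iff.1 (inter_mem (extChartAt_target_mem_nhdsWithin x) hS)
  have A : (extChartAt I x) ⁻¹' (ball (extChartAt I x x) r ∩ range I) ∈ 𝓝 x := by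
    apply extChartAt_preimage_mem_nhds_of_mem_nhdsWithin (by simp)
    rw [inter_comm]
    exact inter_mem_nhdsWithin _ (ball_mem_nhds _ r_pos)
  refine ⟨C, _, inter_mem A (chart_source_mem_nhds H x), ?_⟩
  rintro y ⟨hy, h'y⟩ z ⟨hz, h'z⟩
  let η := ContinuousAffineMap.lineMap (R := ℝ) (extChartAt I x y) (extChartAt I x z)
  set γ := (extChartAt I x).symm ∘ η
  have hη : Icc 0 1 ⊆ ⇑η ⁻¹' ((extChartAt I x).target ∩ S) := by
    simp only [← image_subset_iff, ContinuousAffineMap.coe_lineMap_eq,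
     ← segment_eq_image_lineMap, η]
    apply Subset.trans _ hr
    exact ((convex_ball _ _).inter I.convex_range).segment_subset hy hz
  simp only [preimage_inter, subset_inter_iff] at hη
  have η_smooth : CMDiff[Icc 0 1] 1 η := by
    apply ContMDiff.contMDiffOn
    rw [contMDiff_iff_contDiff]
    exact ContinuousAffineMap.contDiff _
  have : riemannianEDist I y z ≤ pathELength I γ 0 1 := by
    apply riemannianEDist_le_pathELength _ _ _ zero_le_one
    · exact (contMDiffOn_extChartAt_symm x).comp η_smooth hη.1
    · simp [γ, η, ContinuousAffineMap.coe_lineMap_eq, h'y]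
    · simp [γ, η, ContinuousAffineMap.coe_lineMap_eq, h'z]
  rw [IsRiemannianManifold.out (I := I) y z]
  apply this.trans
  rw [← lintegral_fderiv_lineMap_eq_edist, pathELength_eq_lintegral_mfderivWithin_Icc,
    ← lintegral_const_mul' _ _ ENNReal.coe_ne_top]
  apply setLIntegral_mono' measurableSet_Icc (fun t ht ↦ ?_)
  have : mfderiv[Icc 0 1] γ t =
      (mfderiv[range I] (extChartAt I x).symm (η t)) ∘L (mfderiv[Icc 0 1] η t) := by
    apply mfderivWithin_comp
    · exact mdifferentiableWithinAt_extChartAt_symm (hη.1 ht)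
    · exact η_smooth.mdifferentiableOn one_ne_zero t ht
    · exact hη.1.trans (preimage_mono (extChartAt_target_subset_range x))
    · rw [uniqueMDiffWithinAt_iff_uniqueDiffWithinAt]
      exact uniqueDiffOn_Icc zero_lt_one t ht
  have : mfderiv[Icc 0 1] γ t 1 =
      (mfderiv[range I] (extChartAt I x).symm (η t)) (mfderiv[Icc 0 1] η t 1) := congr($this 1)
  rw [this]
  apply (ContinuousLinearMap.le_opENorm _ _).trans
  gcongr
  · exact (hSC _ (hη.2 ht)).le
  · simp only [mfderivWithin_eq_fderivWithin]
    exact le_of_eq rfl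

/-- The chart has bounded derivative near `x`, so it stretches a nearly shortest path from `y` to
`z` by at most `C`; the path must be kept in the region of that bound. -/
theorem exists_nhds_edist_extChartAt_le_mul_edist (x : M) :
    ∃ C : ℝ≥0, ∃ s ∈ 𝓝 x, ∀ y ∈ s, ∀ z ∈ s,
      edist (extChartAt I x y) (extChartAt I x z) ≤ C * edist y z := by
  rcases eventually_enorm_mfderiv_extChartAt_lt I x with ⟨C, C_pos, hC⟩
  obtain ⟨S, hS, hSC⟩ := eventually_iff_exists_mem.1 hC
  obtain ⟨r, r_pos, hr⟩ : ∃ r > 0, eball x r ⊆ S ∩ (extChartAt I x).source :=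
    EMetric.mem_nhds_iff.1 (inter_mem hS (extChartAt_source_mem_nhds (I := I) x))
  -- A path of length below `r/2` starting within `r/4` of `x` stays in the ball of radius `r`.
  refine ⟨C, eball x (r / 4), eball_mem_nhds x (ENNReal.div_pos r_pos.ne' (by simp)), ?_⟩
  intro y hy z hz
  have h4 : r / 4 + (r / 4 + r / 4) ≤ r := by
    calc r / 4 + (r / 4 + r / 4) ≤ r / 4 + (r / 4 + r / 4) + r / 4 := le_self_add
      _ = r := by
        rw [← mul_one_div r 4, ← mul_add, ← mul_add, ← mul_add]
        have : (1 / 4 + (1 / 4 + 1 / 4) + 1 / 4 : ℝ≥0∞) = 1 := by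
          rw [show (1 / 4 + (1 / 4 + 1 / 4) + 1 / 4 : ℝ≥0∞) = 4 * (1 / 4) by ring]
          exact ENNReal.mul_div_cancel (by simp) (by simp)
        rw [this, mul_one]
  have hyz : edist y z < r / 4 + r / 4 :=
    (edist_triangle_right y z x).trans_lt (ENNReal.add_lt_add hy hz)
  -- The distance is an infimum of path lengths that need not be attained, so it is approached from
  -- above.
  suffices ∀ ρ, edist y z < ρ →
      edist (extChartAt I x y) (extChartAt I x z) ≤ C * ρ by
    rcases eq_or_ne (edist y z) ⊤ with h | h
    · exact absurd h (edist_ne_top y z)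
    refine ENNReal.le_of_forall_pos_le_add fun ε hε _ => ?_
    have hε' : (0 : ℝ≥0∞) < ε / C :=
      ENNReal.div_pos (by exact_mod_cast hε.ne') ENNReal.coe_ne_top
    refine (this (edist y z + ε / C) (ENNReal.lt_add_right h hε'.ne')).trans ?_
    rw [mul_add, ENNReal.mul_div_cancel (by exact_mod_cast C_pos.ne') ENNReal.coe_ne_top]
  intro ρ hρ
  have hlt : riemannianEDist I y z < min ρ (r / 4 + r / 4) := by
    rw [← IsRiemannianManifold.out (I := I) y z]
    exact lt_min hρ hyz
  rcases exists_lt_locally_constant_of_riemannianEDist_lt hlt zero_lt_one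
    with ⟨γ, hγy, hγz, γ_smooth, hγ, -⟩
  have hmem : ∀ t ∈ Icc (0 : ℝ) 1, γ t ∈ eball x r := by
    intro t ht
    have h1 : edist y (γ t) ≤ pathELength I γ 0 1 := by
      rw [IsRiemannianManifold.out (I := I) y (γ t)]
      exact (riemannianEDist_le_pathELength γ_smooth.contMDiffOn hγy rfl ht.1).trans
        (pathELength_mono le_rfl ht.2)
    have h2 : edist y (γ t) < r / 4 + r / 4 := h1.trans_lt (hγ.trans_le (min_le_right _ _))
    rw [mem_eball, edist_comm]
    refine ((edist_triangle x y (γ t)).trans_lt (ENNReal.add_lt_add ?_ h2)).trans_le h4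
    rwa [edist_comm]
  let γ' := extChartAt I x ∘ γ
  have hsrc : ∀ t ∈ Icc (0 : ℝ) 1, γ t ∈ (chartAt H x).source := fun t ht => by
    simpa [extChartAt_source I x] using (hr (hmem t ht)).2
  have hC' : CMDiff[Icc 0 1] 1 γ' :=
    contMDiffOn_extChartAt.comp (I' := I) (t := (chartAt H x).source)
      γ_smooth.contMDiffOn (fun t' ht' ↦ hsrc t' ht')
  calc edist (extChartAt I x y) (extChartAt I x z) = ‖γ' 1 - γ' 0‖ₑ := by
        rw [edist_comm, edist_eq_enorm_sub]; simp [γ', hγy, hγz]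
    _ ≤ ∫⁻ t' in Icc 0 1, ‖derivWithin γ' (Icc 0 1) t'‖ₑ := by
      apply enorm_sub_le_lintegral_derivWithin_Icc_of_contDiffOn_Icc _ zero_le_one
      rwa [← contMDiffOn_iff_contDiffOn]
    _ = ∫⁻ t' in Icc 0 1, ‖mfderiv[Icc 0 1] γ' t' 1‖ₑ := by
      simp_rw [← fderivWithin_derivWithin, mfderivWithin_eq_fderivWithin]
      rfl
    _ ≤ ∫⁻ t' in Icc 0 1, C * ‖mfderiv[Icc 0 1] γ t' 1‖ₑ := by
      apply setLIntegral_mono' measurableSet_Icc (fun t' ht' ↦ ?_)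
      have : mfderiv[Icc 0 1] γ' t' =
          (mfderiv% (extChartAt I x) (γ t')) ∘L (mfderiv[Icc 0 1] γ t') := by
        apply mfderiv_comp_mfderivWithin
        · exact mdifferentiableAt_extChartAt (hsrc t' ht')
        · exact (γ_smooth.mdifferentiable one_ne_zero).mdifferentiableOn _ ht'
        · rw [uniqueMDiffWithinAt_iff_uniqueDiffWithinAt]
          exact uniqueDiffOn_Icc zero_lt_one _ ht'
      have : mfderiv[Icc 0 1] γ' t' 1 =
          (mfderiv% (extChartAt I x) (γ t')) (mfderiv[Icc 0 1] γ t' 1) :=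
        congr($this 1)
      rw [this]
      apply (ContinuousLinearMap.le_opENorm _ _).trans
      gcongr
      exact (hSC _ (hr (hmem t' ht')).1).le
    _ = C * pathELength I γ 0 1 := by
      rw [lintegral_const_mul' _ _ ENNReal.coe_ne_top,
          pathELength_eq_lintegral_mfderivWithin_Icc]
    _ ≤ C * ρ := by
      gcongr
      exact hγ.le.trans (min_le_left _ _)

end RiemannianCharts

/-- A metric space is locally bi-Lipschitz to `ℝⁿ` (with the supremum metric) if around every
point there is a bi-Lipschitz map of a ball to `ℝⁿ` whose image contains a ball. -/
def LocallyBilipschitz (n : ℕ) (X : Type*) [MetricSpace X] : Prop :=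
  ∀ x : X, ∃ f : X → Fin n → ℝ, ∃ K > 0, ∃ r > 0, ∃ ρ > 0,
    (∀ y ∈ Metric.ball x r, ∀ z ∈ Metric.ball x r,
      dist y z ≤ K * dist (f y) (f z) ∧ dist (f y) (f z) ≤ K * dist y z) ∧
    Metric.ball (f x) ρ ⊆ f '' Metric.ball x r

/-- The Euclidean and supremum norms are equivalent, which costs the factors `A` and `L`; the image
contains a ball because the chart is a local homeomorphism onto a neighbourhood, the model having no
boundary. -/
theorem locallyBilipschitz_of_isRiemannianManifold (n : ℕ) (X : Type*) [MetricSpace X]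
    [ChartedSpace (EuclideanSpace ℝ (Fin n)) X] [IsManifold (𝓡 n) ∞ X]
    [Bundle.RiemannianBundle (fun x : X => TangentSpace (𝓡 n) x)]
    [IsContMDiffRiemannianBundle (𝓡 n) ∞ (EuclideanSpace ℝ (Fin n))
      (fun x : X => TangentSpace (𝓡 n) x)]
    [IsRiemannianManifold (𝓡 n) X] : LocallyBilipschitz n X := by
  intro x
  have : IsManifold (𝓡 n) 1 X := .of_le (n := ∞) (by simp)
  have : IsContinuousRiemannianBundle (EuclideanSpace ℝ (Fin n))
      (fun x : X => TangentSpace (𝓡 n) x) := by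
    obtain ⟨g, hg, h⟩ := IsContMDiffRiemannianBundle.exists_contMDiff (IB := 𝓡 n) (n := ∞)
      (F := EuclideanSpace ℝ (Fin n)) (E := fun x : X => TangentSpace (𝓡 n) x)
    exact ⟨g, hg.continuous, h⟩
  obtain ⟨C, s, hs, hC⟩ := exists_nhds_edist_le_mul_edist_extChartAt (𝓡 n) x
  obtain ⟨D, t, ht, hD⟩ := exists_nhds_edist_extChartAt_le_mul_edist (𝓡 n) x
  obtain ⟨r, hr, hrst⟩ := Metric.mem_nhds_iff.1 (inter_mem hs ht)
  obtain ⟨L, hL⟩ : ∃ L : ℝ≥0, LipschitzWith L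
      (WithLp.ofLp : EuclideanSpace ℝ (Fin n) → Fin n → ℝ) := ⟨_, PiLp.lipschitzWith_ofLp 2 _⟩
  obtain ⟨A, hA⟩ : ∃ A : ℝ≥0, AntilipschitzWith A
      (WithLp.ofLp : EuclideanSpace ℝ (Fin n) → Fin n → ℝ) := ⟨_, PiLp.antilipschitzWith_ofLp 2 _⟩
  let f : X → Fin n → ℝ := fun y => WithLp.ofLp (extChartAt (𝓡 n) x y)
  have hmap : map f (𝓝 x) = 𝓝 (f x) := by
    have h1 := map_extChartAt_nhds_of_boundaryless (I := 𝓡 n) x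
    have h2 := (PiLp.homeomorph 2 (fun _ : Fin n => ℝ)).map_nhds_eq (extChartAt (𝓡 n) x x)
    rw [← h1, Filter.map_map] at h2
    exact h2
  have himg : f '' Metric.ball x r ∈ 𝓝 (f x) := by
    rw [← hmap]
    exact image_mem_map (Metric.ball_mem_nhds x hr)
  obtain ⟨ρ, hρ, hρf⟩ := Metric.mem_nhds_iff.1 himg
  refine ⟨f, C * A + L * D + 1, by positivity, r, hr, ρ, hρ, fun y hy z hz => ⟨?_, ?_⟩, hρf⟩
  · have h1 := hC y (hrst hy).1 z (hrst hz).1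
    have h2 := hA.le_mul_dist (extChartAt (𝓡 n) x y) (extChartAt (𝓡 n) x z)
    have h1' : dist y z ≤ C * dist (extChartAt (𝓡 n) x y) (extChartAt (𝓡 n) x z) := by
      rw [edist_nndist, edist_nndist] at h1
      exact_mod_cast h1
    change _ ≤ A * dist (f y) (f z) at h2
    have h3 : (C : ℝ) * dist (extChartAt (𝓡 n) x y) (extChartAt (𝓡 n) x z)
      ≤ C * (A * dist (f y) (f z)) := by gcongr
    have : 0 ≤ (L * D + 1 : ℝ) * dist (f y) (f z) := by positivity
    linarith
  · have h1 := hD y (hrst hy).2 z (hrst hz).2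
    have h2 := hL.dist_le_mul (extChartAt (𝓡 n) x y) (extChartAt (𝓡 n) x z)
    have h1' : dist (extChartAt (𝓡 n) x y) (extChartAt (𝓡 n) x z) ≤ D * dist y z := by
      rw [edist_nndist, edist_nndist] at h1
      exact_mod_cast h1
    change dist (f y) (f z) ≤ _ at h2
    have h3 : (L : ℝ) * dist (extChartAt (𝓡 n) x y) (extChartAt (𝓡 n) x z)
      ≤ L * (D * dist y z) := by gcongr
    have : 0 ≤ (C * A + 1 : ℝ) * dist y z := by positivity
    linarith

/-! ### Separated sets in spaces that are locally bi-Lipschitz to `ℝⁿ` -/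

/-- A cube of a space that is locally bi-Lipschitz to `ℝⁿ` contains, for every `m`, a grid of
`mⁿ` points of mesh comparable to `1 / m`, each with a companion at comparable distance. -/
theorem LocallyBilipschitz.exists_grid {n : ℕ} (hn : 0 < n) {X : Type*} [MetricSpace X]
    [Nonempty X] (hX : LocallyBilipschitz n X) :
    ∃ c > 0, ∃ C > 0, ∀ m : ℕ, 0 < m → ∃ x y : (Fin n → Fin m) → X,
      (∀ a b, a ≠ b → c / m ≤ dist (x a) (x b)) ∧
      ∀ a, c / m ≤ dist (x a) (y a) ∧ dist (x a) (y a) ≤ C / m := by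
  obtain ⟨x₀⟩ := ‹Nonempty X›
  obtain ⟨f, K, hK, r, hr, ρ, hρ, hf, hball⟩ := hX x₀
  -- The grid in the chart has mesh `ρ / (2m)` and fills a cube of side `ρ/2`; passing back to `X`
  -- divides or multiplies distances by at most `K`. The companion of a grid point is its translate
  -- by one mesh in every coordinate.
  refine ⟨ρ / (2 * K), by positivity, K * ρ / 2, by positivity, fun m hm => ?_⟩
  have hm' : (0 : ℝ) < m := by exact_mod_cast hm
  choose! h hh using fun u (hu : u ∈ Metric.ball (f x₀) ρ) => hball hu
  have hδ : 0 < ρ / (2 * m) := by positivity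
  have hmem : ∀ s : Fin n → ℝ, (∀ i, 0 ≤ s i ∧ s i ≤ m) →
      f x₀ + (ρ / (2 * m)) • s ∈ Metric.ball (f x₀) ρ := by
    intro s hs
    rw [Metric.mem_ball, dist_pi_lt_iff hρ]
    intro i
    simp only [Pi.add_apply, Pi.smul_apply, smul_eq_mul, Real.dist_eq, add_sub_cancel_left]
    rw [abs_of_nonneg (mul_nonneg hδ.le (hs i).1)]
    calc ρ / (2 * m) * s i ≤ ρ / (2 * m) * m := by gcongr; exact (hs i).2
      _ = ρ / 2 := by field_simp
      _ < ρ := by linarith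
  have hdist : ∀ s t : Fin n → ℝ, dist (f x₀ + (ρ / (2 * m)) • s) (f x₀ + (ρ / (2 * m)) • t) =
      ρ / (2 * m) * dist s t := by
    intro s t
    rw [dist_add_left, dist_smul₀, Real.norm_eq_abs, abs_of_pos hδ]
  let p : (Fin n → Fin m) → Fin n → ℝ := fun a i => ((a i : ℕ) : ℝ)
  have hp : ∀ a i, 0 ≤ p a i ∧ p a i + 1 ≤ m := fun a i =>
    ⟨Nat.cast_nonneg _, by simpa [p] using (Nat.cast_le (α := ℝ)).2 (a i).2⟩
  have hp1 := fun a => hh _ (hmem (p a) fun i => ⟨(hp a i).1, by linarith [(hp a i).2]⟩)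
  have hp2 := fun a => hh _ (hmem (p a + 1) fun i =>
    ⟨add_nonneg (hp a i).1 zero_le_one, (hp a i).2⟩)
  refine ⟨fun a => h (f x₀ + (ρ / (2 * m)) • p a),
    fun a => h (f x₀ + (ρ / (2 * m)) • (p a + 1)), fun a b hab => ?_, fun a => ?_⟩
  · have h1 := (hf _ (hp1 a).1 _ (hp1 b).1).2
    rw [(hp1 a).2, (hp1 b).2, hdist] at h1
    have h2 : 1 ≤ dist (p a) (p b) := by
      obtain ⟨i, hi⟩ := Function.ne_iff.1 hab
      refine le_trans ?_ (dist_le_pi_dist _ _ i)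
      have : (1 : ℤ) ≤ |((a i : ℕ) : ℤ) - ((b i : ℕ) : ℤ)| := by
        apply Int.one_le_abs
        intro h0
        exact hi (Fin.ext (by omega))
      rw [Real.dist_eq]
      simpa [p] using (Int.cast_le (R := ℝ)).2 this
    have h3 : ρ / (2 * m) * 1 ≤ ρ / (2 * m) * dist (p a) (p b) := by gcongr
    have h4 : ρ / (2 * m) ≤ K * dist (h (f x₀ + (ρ / (2 * m)) • p a))
        (h (f x₀ + (ρ / (2 * m)) • p b)) := by linarith
    calc ρ / (2 * K) / m = ρ / (2 * m) / K := by field_simp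
      _ ≤ _ := by rwa [div_le_iff₀' hK]
  · have h1 := hf _ (hp1 a).1 _ (hp2 a).1
    -- This needs `n > 0`: a supremum over no coordinates would be `0`.
    have h2 : dist (p a) (p a + 1) = 1 := by
      have : Nonempty (Fin n) := ⟨⟨0, hn⟩⟩
      rw [dist_self_add_right]
      simp
    rw [(hp1 a).2, (hp2 a).2, hdist, h2, mul_one] at h1
    constructor
    · calc ρ / (2 * K) / m = ρ / (2 * m) / K := by field_simp
        _ ≤ _ := by rw [div_le_iff₀' hK]; exact h1.2
    · calc _ ≤ _ := h1.1
        _ = _ := by field_simp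

/-- Two points in the same cell of a cubic grid of side `δ` are at distance less than `δ`, so
distinct points lie in distinct cells. Each coordinate meets at most `2R/δ + 2 ≤ 4R/δ` cells, since
`δ ≤ R`. -/
theorem card_le_of_separated_pi {n : ℕ} {X : Type*} (g : X → Fin n → ℝ) (u : Fin n → ℝ) {δ R : ℝ}
    (hδ : 0 < δ) (hδR : δ ≤ R) (F : Finset X) (hR : ∀ y ∈ F, dist (g y) u ≤ R)
    (hF : ∀ y ∈ F, ∀ z ∈ F, y ≠ z → δ ≤ dist (g y) (g z)) :
    (F.card : ℝ) ≤ (4 * (R / δ)) ^ n := by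
  have h1 : 1 ≤ R / δ := by rwa [le_div_iff₀ hδ, one_mul]
  have hcard : F.card ≤ (Fintype.piFinset fun _ : Fin n =>
      Finset.Icc ⌊-(R / δ)⌋ ⌊R / δ⌋).card := by
    refine Finset.card_le_card_of_injOn (fun y i => ⌊(g y i - u i) / δ⌋) ?_ ?_
    · intro y hy
      simp only [Finset.mem_coe, Fintype.mem_piFinset, Finset.mem_Icc]
      intro i
      have h := (dist_le_pi_dist (g y) u i).trans (hR y hy)
      rw [Real.dist_eq, abs_le] at h
      constructor
      · apply Int.floor_mono
        rw [← neg_div]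
        gcongr
        exact h.1
      · apply Int.floor_mono
        gcongr
        exact h.2
    · intro y hy z hz hyz
      by_contra hne
      refine (hF y hy z hz hne).not_gt ((dist_pi_lt_iff hδ).2 fun i => ?_)
      have h := Int.abs_sub_lt_one_of_floor_eq_floor (congrFun hyz i)
      rw [← sub_div, sub_sub_sub_cancel_right, abs_div, abs_of_pos hδ, div_lt_one hδ] at h
      exact h
  rw [Fintype.card_piFinset, Finset.prod_const, Finset.card_univ, Fintype.card_fin,
    Int.card_Icc] at hcard
  have h2 : (((⌊R / δ⌋ + 1 - ⌊-(R / δ)⌋).toNat : ℕ) : ℝ) ≤ 4 * (R / δ) := by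
    have h3 : ⌊-(R / δ)⌋ ≤ ⌊R / δ⌋ := Int.floor_mono (by linarith)
    have h4 : (((⌊R / δ⌋ + 1 - ⌊-(R / δ)⌋).toNat : ℤ) : ℝ) =
        (⌊R / δ⌋ : ℝ) + 1 - (⌊-(R / δ)⌋ : ℝ) := by
      rw [Int.toNat_of_nonneg (by omega)]
      push_cast
      ring
    rw [Int.cast_natCast] at h4
    rw [h4]
    have h5 := Int.floor_le (R / δ)
    have h6 := Int.lt_floor_add_one (-(R / δ))
    linarith
  calc (F.card : ℝ) ≤ (((⌊R / δ⌋ + 1 - ⌊-(R / δ)⌋).toNat : ℕ) : ℝ) ^ n := by exact_mod_cast hcard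
    _ ≤ _ := by gcongr

/-- The cardinality of a `δ`-separated subset of a ball of radius `R ≥ δ` in a compact space that
is locally bi-Lipschitz to `ℝⁿ` is at most a constant multiple of `(R / δ) ^ n`. -/
theorem LocallyBilipschitz.exists_card_le {n : ℕ} {X : Type*} [MetricSpace X]
    [CompactSpace X] (hX : LocallyBilipschitz n X) :
    ∃ C : ℝ, 0 ≤ C ∧ ∀ (x : X) (δ R : ℝ), 0 < δ → δ ≤ R → ∀ F : Finset X,
      (∀ y ∈ F, dist y x ≤ R) → (∀ y ∈ F, ∀ z ∈ F, y ≠ z → δ ≤ dist y z) →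
      (F.card : ℝ) ≤ C * (R / δ) ^ n := by
  classical
  -- Restricting `F` to a set `s` gives a property that passes to subsets and finite unions, so by
  -- compactness it suffices to treat chart balls.
  suffices ∃ C : ℝ, 0 ≤ C ∧ ∀ (x : X) (δ R : ℝ), 0 < δ → δ ≤ R → ∀ F : Finset X,
      (∀ y ∈ F, y ∈ (univ : Set X)) →
      (∀ y ∈ F, dist y x ≤ R) → (∀ y ∈ F, ∀ z ∈ F, y ≠ z → δ ≤ dist y z) →
      (F.card : ℝ) ≤ C * (R / δ) ^ n by simpa using this
  refine (isCompact_univ (X := X)).induction_on (p := fun s =>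
    ∃ C : ℝ, 0 ≤ C ∧ ∀ (x : X) (δ R : ℝ), 0 < δ → δ ≤ R → ∀ F : Finset X,
      (∀ y ∈ F, y ∈ s) →
      (∀ y ∈ F, dist y x ≤ R) → (∀ y ∈ F, ∀ z ∈ F, y ≠ z → δ ≤ dist y z) →
      (F.card : ℝ) ≤ C * (R / δ) ^ n) ?_ ?_ ?_ ?_
  · refine ⟨0, le_rfl, fun x δ R _ _ F h _ _ => ?_⟩
    rw [Finset.eq_empty_of_forall_notMem (s := F) fun y hy => h y hy]
    simp
  · rintro s t hst ⟨C, hC, h⟩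
    exact ⟨C, hC, fun x δ R h1 h2 F h3 => h x δ R h1 h2 F fun y hy => hst (h3 y hy)⟩
  · rintro s t ⟨C, hC, h⟩ ⟨D, hD, h'⟩
    refine ⟨C + D, by positivity, fun x δ R h1 h2 F h3 h4 h5 => ?_⟩
    have e1 := h x δ R h1 h2 (F.filter (· ∈ s)) (by simp) (fun y hy => h4 y (Finset.filter_subset _ _ hy))
      (fun y hy z hz => h5 y (Finset.filter_subset _ _ hy) z (Finset.filter_subset _ _ hz))
    have e2 := h' x δ R h1 h2 (F.filter (¬ · ∈ s))
      (fun y hy => ((h3 y (Finset.filter_subset _ _ hy)).resolve_left (Finset.mem_filter.1 hy).2))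
      (fun y hy => h4 y (Finset.filter_subset _ _ hy))
      (fun y hy z hz => h5 y (Finset.filter_subset _ _ hy) z (Finset.filter_subset _ _ hz))
    rw [← Finset.card_filter_add_card_filter_not (s := F) (· ∈ s), add_mul]
    push_cast
    exact add_le_add e1 e2
  · intro x₀ _
    obtain ⟨f, K, hK, r, hr, -, -, hf, -⟩ := hX x₀
    refine ⟨Metric.ball x₀ r, mem_nhdsWithin_of_mem_nhds (Metric.ball_mem_nhds _ hr),
      (8 * (K + 1) ^ 2) ^ n, by positivity, fun x δ R hδ hδR F h3 h4 h5 => ?_⟩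
    rcases F.eq_empty_or_nonempty with rfl | ⟨y₀, hy₀⟩
    · simp only [Finset.card_empty, Nat.cast_zero]
      have : 0 ≤ R := hδ.le.trans hδR
      positivity
    have hR : 0 < R := hδ.trans_le hδR
    -- The centre `x` may lie outside the chart ball, so it is replaced by a point `y₀` of `F`,
    -- which doubles the radius. Using `K + 1` for `K` ensures that the new separation does not
    -- exceed the new radius.
    have key := card_le_of_separated_pi f (f y₀) (δ := δ / (K + 1)) (R := (K + 1) * (2 * R))
      (by positivity) ?_ F ?_ ?_
    · refine key.trans_eq ?_
      rw [← mul_pow]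
      congr 1
      field_simp
      ring
    · rw [div_le_iff₀ (by positivity)]
      nlinarith [mul_pos hK hR, mul_pos hK (mul_pos hK hR)]
    · intro y hy
      refine (hf y (h3 y hy) y₀ (h3 y₀ hy₀)).2.trans ?_
      have : dist y y₀ ≤ 2 * R := by
        linarith [dist_triangle_right y y₀ x, h4 y hy, h4 y₀ hy₀]
      gcongr
      linarith
    · intro y hy z hz hyz
      rw [div_le_iff₀' (by positivity)]
      have h1 := (hf y (h3 y hy) z (h3 z hz)).1
      have h2 := h5 y hy z hz hyz
      have h3 : 0 ≤ dist (f y) (f z) := dist_nonneg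
      linarith

/-- Maximal separated sets in a compact space that is locally bi-Lipschitz to `ℝⁿ`. -/
theorem LocallyBilipschitz.exists_net {n : ℕ} {X : Type*} [MetricSpace X]
    [CompactSpace X] (hX : LocallyBilipschitz n X) {δ : ℝ} (hδ : 0 < δ) :
    ∃ F : Finset X, (∀ y ∈ F, ∀ z ∈ F, y ≠ z → δ ≤ dist y z) ∧ ∀ x, ∃ y ∈ F, dist x y < δ := by
  classical
  obtain ⟨C, hC, h⟩ := hX.exists_card_le
  let s : Set ℕ := {k | ∃ F : Finset X, (∀ y ∈ F, ∀ z ∈ F, y ≠ z → δ ≤ dist y z) ∧ F.card = k}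
  have hne : s.Nonempty := ⟨0, ∅, by simp, rfl⟩
  have hb : BddAbove s := by
    rcases isEmpty_or_nonempty X with hX' | ⟨⟨x₀⟩⟩
    · refine ⟨0, ?_⟩
      rintro k ⟨F, -, rfl⟩
      simp [Finset.eq_empty_of_isEmpty F]
    · refine ⟨⌊C * (max δ (Metric.diam (univ : Set X)) / δ) ^ n⌋₊, ?_⟩
      rintro k ⟨F, hF, rfl⟩
      refine Nat.le_floor (h x₀ δ _ hδ (le_max_left _ _) F (fun y _ => ?_) hF)
      exact (Metric.dist_le_diam_of_mem isCompact_univ.isBounded (mem_univ _) (mem_univ _)).trans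
        (le_max_right _ _)
  obtain ⟨F, hF, hcard⟩ := Nat.sSup_mem hne hb
  refine ⟨F, hF, fun x => ?_⟩
  by_contra! hx
  have hxF : x ∉ F := fun hmem => by
    have := hx x hmem
    rw [dist_self] at this
    linarith
  have hmem : (insert x F).card ∈ s := by
    refine ⟨insert x F, ?_, rfl⟩
    intro y hy z hz hyz
    rw [Finset.mem_insert] at hy hz
    rcases hy with rfl | hy <;> rcases hz with rfl | hz
    · exact absurd rfl hyz
    · exact hx z hz
    · rw [dist_comm]
      exact hx y hy
    · exact hF y hy z hz hyz
  have := le_csSup hb hmem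
  rw [Finset.card_insert_of_notMem hxF, ← hcard] at this
  omega

/-! ### A sparse symmetric set of infinite local density -/

/-- A pair of length between `2^(-k-1)` and `2^(-k)` is within `2^(-k)/(k+1)` of a pair of net
points, so the density ratio is at least `(k+1)/2`. -/
theorem localDensity_eq_top_of_nets {X : Type*} [MetricSpace X] (N : ℕ → Finset X)
    (hN : ∀ k x, ∃ y ∈ N k, dist x y < (1 / 2) ^ k / (k + 1)) :
    localDensity (⋃ k, {z : X × X | z.1 ∈ N k ∧ z.2 ∈ N k ∧ z.1 ≠ z.2 ∧
      dist z.1 z.2 ≤ 4 * (1 / 2) ^ k}) = ⊤ := by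
  refine ENNReal.eq_top_of_forall_nnreal_le fun D => ?_
  -- The term `2D` gives density `D`; the `4` makes the error at most a fifth of `2^(-k)`, so that
  -- the two net points are distinct and at an admissible distance.
  obtain ⟨k₀, hk₀⟩ := exists_nat_ge (2 * (D : ℝ) + 4)
  refine le_iSup₂_of_le ((1 / 2 : ℝ) ^ k₀) (by simp) (le_iInf₂ ?_)
  rintro ⟨x, y⟩ ⟨hne, hle⟩
  simp only at hne hle
  have hpos : 0 < dist x y := dist_pos.2 hne
  obtain ⟨k, hk1, hk2⟩ := exists_nat_pow_near_of_lt_one hpos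
    (hle.trans (pow_le_one₀ (by norm_num) (by norm_num))) (by norm_num : (0 : ℝ) < 1 / 2)
    (by norm_num)
  have hkk : k₀ ≤ k := by
    by_contra! hlt
    have : (1 / 2 : ℝ) ^ k₀ ≤ (1 / 2) ^ (k + 1) :=
      pow_le_pow_of_le_one (by norm_num) (by norm_num) hlt
    linarith
  have hkR : 2 * (D : ℝ) + 4 ≤ k := hk₀.trans (by exact_mod_cast hkk)
  have hD : (0 : ℝ) ≤ D := D.2
  obtain ⟨x', hx', hxx'⟩ := hN k x
  obtain ⟨y', hy', hyy'⟩ := hN k y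
  set δ : ℝ := (1 / 2) ^ k / (k + 1) with hδ
  have hkey : δ * (k + 1) = (1 / 2) ^ k := by rw [hδ]; field_simp
  have hδ0 : 0 < δ := by positivity
  rw [pow_succ] at hk1
  have h4 : δ * 5 ≤ (1 / 2) ^ k := by rw [← hkey]; gcongr; linarith
  have h5 : δ * (2 * D) ≤ (1 / 2) ^ k := by rw [← hkey]; gcongr; linarith
  have e1 : dist x y ≤ dist x x' + dist x' y' + dist y y' := by
    rw [dist_comm y y']
    exact dist_triangle4 _ _ _ _
  have e2 : dist x' y' ≤ dist x x' + dist x y + dist y y' := by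
    rw [dist_comm x x']
    exact dist_triangle4 _ _ _ _
  refine le_iSup₂_of_le (x', y') (mem_iUnion.2 ⟨k, hx', hy', ?_, ?_⟩) ?_
  · apply dist_pos.1
    linarith
  · change dist x' y' ≤ _
    linarith
  · have h0 : edist x y ≠ 0 := by simpa using hne
    rw [ENNReal.le_div_iff_mul_le (.inr h0) (.inr (edist_ne_top x y)),
      edist_nndist, edist_nndist, ← ENNReal.coe_mul, ENNReal.coe_le_coe, ← NNReal.coe_le_coe]
    push_cast
    have : dist (x, y) (x', y') ≤ δ := by
      rw [Prod.dist_eq]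
      exact max_le hxx'.le hyy'.le
    have : (D : ℝ) * dist (x, y) (x', y') ≤ D * δ := by gcongr
    linarith

theorem LocallyBilipschitz.exists_localDensity_eq_top {n : ℕ} {X : Type*} [MetricSpace X]
    [CompactSpace X] (hX : LocallyBilipschitz n X) :
    ∃ S : Set (X × X), (∀ z ∈ S, z.swap ∈ S) ∧ (∀ z ∈ S, z.1 ≠ z.2) ∧
      (∀ q : ℝ, n < q → Summable fun s : S => dist s.1.1 s.1.2 ^ q) ∧ localDensity S = ⊤ := by
  classical
  have hδ : ∀ k : ℕ, (0 : ℝ) < (1 / 2) ^ k / (k + 1) := fun k => by positivity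
  choose N hsep hN using fun k => hX.exists_net (hδ k)
  refine ⟨_, ?_, ?_, ?_, localDensity_eq_top_of_nets N hN⟩
  · intro z hz
    simp only [mem_iUnion] at hz ⊢
    obtain ⟨k, h1, h2, h3, h4⟩ := hz
    exact ⟨k, h2, h1, h3.symm, by rw [dist_comm]; exact h4⟩
  · intro z hz
    obtain ⟨k, -, -, h3, -⟩ := mem_iUnion.1 hz
    exact h3
  intro q hq
  have hq0 : 0 < q := n.cast_nonneg.trans_lt hq
  obtain ⟨C, hC, h⟩ := hX.exists_card_le
  let T : ℕ → Finset (X × X) := fun k =>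
    (N k ×ˢ N k).filter fun z => z.1 ≠ z.2 ∧ dist z.1 z.2 ≤ 4 * (1 / 2) ^ k
  let D : ℝ := max 1 (Metric.diam (univ : Set X))
  have hD : 1 ≤ D := le_max_left _ _
  have hle1 : ∀ k : ℕ, (1 / 2 : ℝ) ^ k / (k + 1) ≤ (1 / 2) ^ k := fun k =>
    div_le_self (by positivity) (by linarith [k.cast_nonneg (α := ℝ)])
  have hcardN : ∀ k, ((N k).card : ℝ) ≤ C * (D * ((k + 1) * 2 ^ k)) ^ n := by
    intro k
    rcases isEmpty_or_nonempty X with hX' | ⟨⟨x₀⟩⟩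
    · simp only [Finset.eq_empty_of_isEmpty, Finset.card_empty, Nat.cast_zero]
      positivity
    refine (h x₀ _ D (hδ k) ?_ (N k) (fun y _ => ?_) (hsep k)).trans_eq ?_
    · exact ((hle1 k).trans (pow_le_one₀ (by norm_num) (by norm_num))).trans hD
    · exact (Metric.dist_le_diam_of_mem isCompact_univ.isBounded (mem_univ _) (mem_univ _)).trans
        (le_max_right _ _)
    · rw [one_div, inv_pow]
      field_simp
  have hcardT : ∀ k, ((T k).card : ℝ) ≤
      (C * (D * ((k + 1) * 2 ^ k)) ^ n) * (C * (4 * (k + 1)) ^ n) := by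
    intro k
    -- Pairs are grouped by first point; the possible second points form a separated set in a ball
    -- whose radius is `4(k+1)` times the separation.
    have h1 : (T k).card ≤ ∑ x ∈ N k, ((N k).filter fun y => dist y x ≤ 4 * (1 / 2) ^ k).card := by
      rw [← Finset.card_sigma]
      refine Finset.card_le_card_of_injOn (fun z => ⟨z.1, z.2⟩) ?_ ?_
      · intro z hz
        simp only [T, Finset.mem_coe, Finset.mem_filter, Finset.mem_product] at hz
        simp only [Finset.mem_coe, Finset.mem_sigma, Finset.mem_filter]
        exact ⟨hz.1.1, hz.1.2, by rw [dist_comm]; exact hz.2.2⟩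
      · rintro ⟨a, b⟩ - ⟨c, d⟩ - he
        simpa using he
    have h2 : ∀ x ∈ N k, (((N k).filter fun y => dist y x ≤ 4 * (1 / 2) ^ k).card : ℝ) ≤
        C * (4 * (k + 1)) ^ n := by
      intro x _
      refine (h x _ (4 * (1 / 2) ^ k) (hδ k) ?_ _ (fun y hy => (Finset.mem_filter.1 hy).2)
        (fun y hy z hz => hsep k y (Finset.filter_subset _ _ hy) z
          (Finset.filter_subset _ _ hz))).trans_eq ?_
      · have := hle1 k
        have : (0 : ℝ) < (1 / 2) ^ k := by positivity
        linarith
      · congr 2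
        field_simp
    calc ((T k).card : ℝ) ≤ ∑ x ∈ N k,
          (((N k).filter fun y => dist y x ≤ 4 * (1 / 2) ^ k).card : ℝ) := by exact_mod_cast h1
      _ ≤ ∑ x ∈ N k, C * (4 * (k + 1)) ^ n := Finset.sum_le_sum h2
      _ = (N k).card * (C * (4 * (k + 1)) ^ n) := by rw [Finset.sum_const, nsmul_eq_mul]
      _ ≤ _ := by
        gcongr
        exact hcardN k
  have hsummable : Summable fun k : ℕ => ((T k).card : ℝ) * (4 * (1 / 2) ^ k) ^ q := by
    let r : ℝ := 2 ^ ((n : ℝ) - q)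
    have hr0 : 0 < r := by positivity
    have hr1 : r < 1 := Real.rpow_lt_one_of_one_lt_of_neg (by norm_num) (by linarith)
    have h1 : Summable fun k : ℕ => ((k : ℝ) ^ (2 * n) * r ^ k) :=
      summable_pow_mul_geometric_of_norm_lt_one _ (by rwa [Real.norm_of_nonneg hr0.le])
    -- The shift produces `(k+1)^(2n) r^(k+1)`; the factor `r⁻¹` removes the extra power.
    have h2 := ((summable_nat_add_iff 1).2 h1).mul_left
      (r⁻¹ * (C * C * (D * 4) ^ n * 4 ^ q))
    refine Summable.of_nonneg_of_le (fun k => by positivity) (fun k => ?_) h2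
    refine (mul_le_mul_of_nonneg_right (hcardT k) (by positivity)).trans_eq ?_
    have hrk : r ^ k = (2 ^ k) ^ n * ((1 / 2 : ℝ) ^ k) ^ q := by
      have h3 : ((1 / 2 : ℝ) ^ k) ^ q = 2 ^ (-(k : ℝ) * q) := by
        rw [Real.rpow_mul (by norm_num), Real.rpow_neg (by norm_num), Real.rpow_natCast, one_div,
          inv_pow]
      have h4 : (((2 : ℝ) ^ k) ^ n) = 2 ^ ((k : ℝ) * n) := by
        rw [Real.rpow_mul (by norm_num), Real.rpow_natCast, Real.rpow_natCast]
      rw [h3, h4, ← Real.rpow_add (by norm_num), ← Real.rpow_natCast,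
        ← Real.rpow_mul (by norm_num)]
      congr 1
      ring
    rw [Real.mul_rpow (by norm_num) (by positivity), pow_succ r k, hrk]
    push_cast
    simp only [mul_pow]
    field_simp
    ring
  -- A pair may occur at several levels. Summing over the disjoint union counts it each time;
  -- choosing one level per pair then embeds `S` in that union.
  have hsigma : Summable fun z : Σ k, T k => dist z.2.1.1 z.2.1.2 ^ q := by
    rw [summable_sigma_of_nonneg fun z => by positivity]
    refine ⟨fun k => Summable.of_finite, Summable.of_nonneg_of_le
      (fun k => tsum_nonneg fun z => by positivity) (fun k => ?_) hsummable⟩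
    rw [tsum_fintype]
    calc _ ≤ ∑ _z : T k, ((4 : ℝ) * (1 / 2) ^ k) ^ q := by
          refine Finset.sum_le_sum fun z _ => ?_
          gcongr
          exact (Finset.mem_filter.1 z.2).2.2
      _ = _ := by simp
  have hmem : ∀ s : ↥(⋃ k, {z : X × X | z.1 ∈ N k ∧ z.2 ∈ N k ∧ z.1 ≠ z.2 ∧
      dist z.1 z.2 ≤ 4 * (1 / 2) ^ k}), ∃ k, s.1 ∈ T k := by
    intro s
    obtain ⟨k, h1, h2, h3⟩ := mem_iUnion.1 s.2
    exact ⟨k, Finset.mem_filter.2 ⟨Finset.mem_product.2 ⟨h1, h2⟩, h3⟩⟩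
  choose κ hκ using hmem
  refine hsigma.comp_injective (i := fun s => (⟨κ s, s.1, hκ s⟩ : Σ k, T k)) ?_
  intro s t hst
  simp only [Sigma.mk.injEq] at hst
  obtain ⟨h1, h2⟩ := hst
  rw [Subtype.heq_iff_coe_eq] at h2
  · exact Subtype.ext h2
  · intro x
    rw [h1]

/-! ### Spectral measures -/

theorem IsOpen.measurableSet_borel {T : Type*} [TopologicalSpace T] {A : Set T} (h : IsOpen A) :
    MeasurableSet[borel T] A :=
  MeasurableSpace.measurableSet_generateFrom h

section StarProjection

variable {H : Type*} [NormedAddCommGroup H] [InnerProductSpace ℂ H] [CompleteSpace H]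
  {p : H →L[ℂ] H}

theorem IsStarProjection.apply_apply (hp : IsStarProjection p) (ξ : H) : p (p ξ) = p ξ :=
  congr($(hp.isIdempotentElem.eq) ξ)

theorem IsStarProjection.inner_apply_left (hp : IsStarProjection p) (ξ η : H) :
    ⟪p ξ, η⟫_ℂ = ⟪ξ, p η⟫_ℂ := by
  rw [← ContinuousLinearMap.adjoint_inner_right, hp.isSelfAdjoint.adjoint_eq]

theorem IsStarProjection.re_inner_apply_self (hp : IsStarProjection p) (ξ : H) :
    RCLike.re ⟪p ξ, ξ⟫_ℂ = ‖p ξ‖ ^ 2 := by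
  rw [← hp.apply_apply ξ, hp.inner_apply_left, inner_self_eq_norm_sq, hp.apply_apply]

theorem IsStarProjection.norm_apply_le (hp : IsStarProjection p) (ξ : H) : ‖p ξ‖ ≤ ‖ξ‖ := by
  have h1 := hp.re_inner_apply_self ξ
  have h2 : RCLike.re ⟪p ξ, ξ⟫_ℂ ≤ ‖p ξ‖ * ‖ξ‖ := re_inner_le_norm _ _
  rcases (norm_nonneg (p ξ)).eq_or_lt with h | h
  · rw [← h]; exact norm_nonneg _
  · rw [h1, sq] at h2
    exact le_of_mul_le_mul_left h2 h

end StarProjection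

namespace SpectralMeasure

variable {T : Type*} [TopologicalSpace T] {H : Type*} [NormedAddCommGroup H]
  [InnerProductSpace ℂ H] [CompleteSpace H] (P : SpectralMeasure T H)

theorem measure_eq_norm_sq (ξ : H) {A : Set T} (hA : MeasurableSet[borel T] A) :
    P.measure ξ A = ENNReal.ofReal (‖P.proj A ξ‖ ^ 2) := by
  rw [P.measure_apply ξ A hA, (P.isStarProjection_proj A hA).re_inner_apply_self]

theorem norm_sq_proj_union (ξ : H) {A B : Set T} (hA : MeasurableSet[borel T] A)
    (hB : MeasurableSet[borel T] B) (h : Disjoint A B) :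
    ‖P.proj (A ∪ B) ξ‖ ^ 2 = ‖P.proj A ξ‖ ^ 2 + ‖P.proj B ξ‖ ^ 2 := by
  let _ := borel T
  have h1 := measure_union (μ := P.measure ξ) h hB
  rw [P.measure_eq_norm_sq ξ (hA.union hB), P.measure_eq_norm_sq ξ hA, P.measure_eq_norm_sq ξ hB,
    ← ENNReal.ofReal_add (by positivity) (by positivity)] at h1
  exact (ENNReal.ofReal_eq_ofReal_iff (by positivity) (by positivity)).1 h1

theorem norm_sq_proj_mono (ξ : H) {A B : Set T} (hA : MeasurableSet[borel T] A)
    (hB : MeasurableSet[borel T] B) (h : A ⊆ B) : ‖P.proj A ξ‖ ^ 2 ≤ ‖P.proj B ξ‖ ^ 2 := by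
  let _ := borel T
  have h1 := measure_mono (μ := P.measure ξ) h
  rw [P.measure_eq_norm_sq ξ hA, P.measure_eq_norm_sq ξ hB] at h1
  exact (ENNReal.ofReal_le_ofReal_iff (by positivity)).1 h1

/-- Multiplicativity of `P` is not an axiom, but follows here from additivity: for `v = P(A)ξ`,
`‖v‖² + ‖P(B)v‖² = ‖P(A ∪ B)v‖² ≤ ‖v‖²`. -/
theorem proj_apply_proj_of_disjoint (ξ : H) {A B : Set T} (hA : MeasurableSet[borel T] A)
    (hB : MeasurableSet[borel T] B) (h : Disjoint A B) : P.proj B (P.proj A ξ) = 0 := by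
  let _ := borel T
  have h1 := P.norm_sq_proj_union (P.proj A ξ) hA hB h
  rw [(P.isStarProjection_proj A hA).apply_apply] at h1
  have h2 := (P.isStarProjection_proj _ (hA.union hB)).norm_apply_le (P.proj A ξ)
  have h3 : ‖P.proj (A ∪ B) (P.proj A ξ)‖ ^ 2 ≤ ‖P.proj A ξ‖ ^ 2 := by gcongr
  have h4 : ‖P.proj B (P.proj A ξ)‖ ^ 2 = 0 :=
    le_antisymm (by linarith) (by positivity)
  simpa using h4

theorem inner_proj_proj_of_disjoint (ξ η : H) {A B : Set T} (hA : MeasurableSet[borel T] A)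
    (hB : MeasurableSet[borel T] B) (h : Disjoint A B) : ⟪P.proj A ξ, P.proj B η⟫_ℂ = 0 := by
  rw [← (P.isStarProjection_proj B hB).inner_apply_left, P.proj_apply_proj_of_disjoint ξ hA hB h,
    inner_zero_left]

end SpectralMeasure

/-! ### Eigenvalues of the absolute value -/

section

variable {H : Type*} [NormedAddCommGroup H] [InnerProductSpace ℂ H]

theorem mem_sqEigenspace {T : H →L[ℂ] H} {lam : ℂ} {v : H} :
    v ∈ sqEigenspace T lam ↔ T (T v) = lam ^ 2 • v := by
  simp [sqEigenspace]

theorem absEigenspaceGE_eq_bot {T : H →L[ℂ] H} {t : ℝ} (ht : ‖T‖ < t) :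
    absEigenspaceGE T t = ⊥ := by
  simp only [absEigenspaceGE, iSup_eq_bot]
  intro s hs
  rw [eq_bot_iff]
  intro v hv
  have hs' : ‖T‖ < s := ht.trans_le hs
  have h0 : 0 ≤ ‖T‖ := norm_nonneg T
  have h1 : s ^ 2 * ‖v‖ ≤ ‖T‖ ^ 2 * ‖v‖ := by
    have h2 : ‖T (T v)‖ = s ^ 2 * ‖v‖ := by
      rw [mem_sqEigenspace.1 hv, norm_smul]
      simp
    rw [← h2, sq, mul_assoc]
    exact (T.le_opNorm _).trans (by gcongr; exact T.le_opNorm _)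
  have h2 : ‖T‖ ^ 2 < s ^ 2 := by gcongr
  by_contra hne
  have : 0 < ‖v‖ := norm_pos_iff.2 hne
  nlinarith

/-- Without this bound the `sSup` in `absEigenvalue` could be the default value `0`. -/
theorem bddAbove_rank_absEigenspaceGE (T : H →L[ℂ] H) (n : ℕ) :
    BddAbove {t : ℝ | 0 < t ∧ (n : Cardinal) < Module.rank ℂ (absEigenspaceGE T t)} := by
  refine ⟨‖T‖, fun t ht => ?_⟩
  by_contra! hlt
  have := ht.2
  rw [absEigenspaceGE_eq_bot hlt] at this
  simp at this

theorem absEigenvalue_nonneg (T : H →L[ℂ] H) (n : ℕ) : 0 ≤ absEigenvalue T n :=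
  Real.sSup_nonneg fun _ ht => ht.1.le

/-- Nonzero pairwise orthogonal vectors are independent, so they bound the rank from below. -/
theorem le_absEigenvalue {T : H →L[ℂ] H} {t : ℝ} (ht : 0 < t) {ι : Type*} [Fintype ι] (v : ι → H)
    (hv : ∀ i, v i ∈ absEigenspaceGE T t) (hne : ∀ i, v i ≠ 0)
    (horth : Pairwise fun i j => ⟪v i, v j⟫_ℂ = 0) {k : ℕ} (hk : k < Fintype.card ι) :
    t ≤ absEigenvalue T k := by
  refine le_csSup (bddAbove_rank_absEigenspaceGE T k) ⟨ht, ?_⟩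
  have h1 : LinearIndependent ℂ v := linearIndependent_of_ne_zero_of_inner_eq_zero hne horth
  have h2 : LinearIndependent ℂ (fun i => (⟨v i, hv i⟩ : absEigenspaceGE T t)) :=
    LinearIndependent.of_comp (absEigenspaceGE T t).subtype h1
  have h3 := h2.cardinal_lift_le_rank
  rw [Cardinal.mk_fintype, Cardinal.lift_natCast, Cardinal.nat_le_lift_iff] at h3
  exact lt_of_lt_of_le (by exact_mod_cast hk) h3

theorem dixmierTraceAbsPow_eq_top (φ : DixmierLimit) {T : H →L[ℂ] H} {n : ℕ} {c : ℝ} (hc : 0 < c)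
    {m₀ : ℕ} (h : ∀ m ≥ m₀, ∀ i < m ^ n, c / m ≤ absEigenvalue T i) {p : ℝ≥0} (hp : p < n) :
    dixmierTraceAbsPow φ T p = ⊤ := by
  rw [dixmierTraceAbsPow, dif_neg]
  rintro ⟨C, hC⟩
  have hn : 0 < n := by
    have : (0 : ℝ≥0) < n := zero_le.trans_lt hp
    exact_mod_cast this
  have hp' : (p : ℝ) < n := by exact_mod_cast hp
  -- Finiteness of the trace is defined through bounded oscillation; comparison with the term at `0`
  -- turns this into an upper bound.
  set B : ℝ := |dixmierSeq T p 0| + C with hB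
  have hbound : ∀ k, dixmierSeq T p k ≤ B := by
    intro k
    have h1 := hC k 0
    rw [Real.dist_eq] at h1
    linarith [le_abs_self (dixmierSeq T p k - dixmierSeq T p 0), le_abs_self (dixmierSeq T p 0)]
  have hC0 : 0 ≤ C := dist_nonneg.trans (hC 0 0)
  have hB0 : 0 ≤ B := by positivity
  have hineq : ∀ m : ℕ, m₀ ≤ m → 2 ≤ m →
      c ^ (p : ℝ) * (m : ℝ) ^ ((n : ℝ) - p) ≤ B * n * Real.log m := by
    intro m hm hm2
    have hm0 : (0 : ℝ) < m := by positivity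
    -- The index of `dixmierSeq` is offset by two: term `k` is the partial sum with `N = k + 2`.
    obtain ⟨k, hk⟩ : ∃ k, m ^ n = k + 2 := by
      have : 2 ≤ m ^ n := hm2.trans (Nat.le_self_pow hn.ne' m)
      exact ⟨m ^ n - 2, by omega⟩
    have h1 := hbound k
    have hcast : (k : ℝ) + 2 = (m : ℝ) ^ n := by exact_mod_cast hk.symm
    have hlog : Real.log ((k : ℝ) + 2) = n * Real.log m := by rw [hcast, Real.log_pow]
    have hlog0 : 0 < Real.log ((k : ℝ) + 2) := Real.log_pos (by linarith [k.cast_nonneg (α := ℝ)])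
    rw [dixmierSeq, div_le_iff₀ hlog0, hlog, ← hk, ← mul_assoc] at h1
    refine le_trans ?_ h1
    have h2 : ∑ i ∈ Finset.range (m ^ n), (c / m) ^ (p : ℝ) ≤ ∑ i ∈ Finset.range (m ^ n),
        if absEigenvalue T i = 0 then 0 else absEigenvalue T i ^ (p : ℝ) := by
      refine Finset.sum_le_sum fun i hi => ?_
      have h3 := h m hm i (Finset.mem_range.1 hi)
      have h4 : 0 < c / m := by positivity
      rw [if_neg (h4.trans_le h3).ne']
      gcongr
    refine le_trans (le_of_eq ?_) h2
    rw [Finset.sum_const, Finset.card_range, nsmul_eq_mul, Real.div_rpow hc.le hm0.le,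
      Real.rpow_sub hm0, Real.rpow_natCast]
    push_cast
    ring
  -- With this `ε` the logarithmic side is at most half of `c^p m^(n-p)`, a contradiction; the `+ 1`
  -- avoids division by zero.
  have hε : 0 < c ^ (p : ℝ) / (2 * (B * n + 1)) := by positivity
  have hsmall := (isLittleO_log_rpow_atTop (sub_pos.2 hp')).bound hε
  have hev := tendsto_natCast_atTop_atTop (R := ℝ) |>.eventually hsmall
  obtain ⟨m, hm1, hm2, hm3⟩ :=
    (hev.and ((eventually_ge_atTop m₀).and (eventually_ge_atTop 2))).exists
  have hm0 : (0 : ℝ) < m := by positivity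
  have h1 := hineq m hm2 hm3
  set x : ℝ := (m : ℝ) ^ ((n : ℝ) - p) with hx
  have hx0 : 0 < x := by positivity
  have h2 : Real.log m ≤ c ^ (p : ℝ) / (2 * (B * n + 1)) * x := by
    rw [Real.norm_of_nonneg hx0.le] at hm1
    exact (le_abs_self _).trans hm1
  have h3 : B * n * Real.log m ≤ B * n * (c ^ (p : ℝ) / (2 * (B * n + 1)) * x) := by gcongr
  have hcp : 0 < c ^ (p : ℝ) := by positivity
  have h4 : B * n * (c ^ (p : ℝ) / (2 * (B * n + 1)) * x) ≤ c ^ (p : ℝ) * x / 2 := by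
    have : B * n * (c ^ (p : ℝ) / (2 * (B * n + 1)) * x) =
        (B * n / (B * n + 1)) * (c ^ (p : ℝ) * x / 2) := by field_simp
    rw [this]
    refine mul_le_of_le_one_left (by positivity) ?_
    rw [div_le_one (by positivity)]
    linarith
  have : 0 < c ^ (p : ℝ) * x := by positivity
  linarith

end

/-! ### The lower bound for the dimension of a spectral geometry -/

namespace SpectralGeometry

variable {X : Type*} [MetricSpace X] [CompactSpace X]

theorem sqEigenspace_norm (M : SpectralGeometry X) {lam : ℂ}
    (h : Module.End.HasEigenvalue (M.ds : Module.End ℂ M.H) lam) :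
    sqEigenspace M.ds ((‖lam‖ : ℝ) : ℂ) = sqEigenspace M.ds lam := by
  have h1 : (starRingEnd ℂ) lam = lam :=
    M.isSelfAdjoint_ds.isSymmetric.conj_eigenvalue_eq_self h
  have h2 : ((‖lam‖ : ℝ) : ℂ) ^ 2 = lam ^ 2 := by
    rw [← Complex.conj_mul', h1, sq]
  rw [sqEigenspace, sqEigenspace, h2]

theorem isOpen_spectralNullSet (M : SpectralGeometry X) (lam : ℂ) :
    IsOpen (spectralNullSet M.P M.ds lam) :=
  isOpen_sUnion fun _ h => h.1

/-- By axiom (iii) the range of `P(A_lam)` is the orthogonal complement of `L_lam`. As `L_lam` is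
closed, it is its own double complement, hence the kernel of this projector. -/
theorem mem_sqEigenspace_iff (M : SpectralGeometry X) {lam : ℂ}
    (h : Module.End.HasEigenvalue (M.ds : Module.End ℂ M.H) lam) {v : M.H} :
    v ∈ sqEigenspace M.ds lam ↔ M.P.proj (spectralNullSet M.P M.ds lam) v = 0 := by
  have hp := M.P.isStarProjection_proj _ (M.isOpen_spectralNullSet lam).measurableSet_borel
  have hclosed : IsClosed (sqEigenspace M.ds lam : Set M.H) := by
    have : (sqEigenspace M.ds lam : Set M.H) = {v | M.ds (M.ds v) = lam ^ 2 • v} := by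
      ext v
      exact mem_sqEigenspace
    rw [this]
    exact isClosed_eq (by fun_prop) (by fun_prop)
  have := hclosed.completeSpace_coe
  rw [← Submodule.orthogonal_orthogonal (sqEigenspace M.ds lam), ← M.range_proj lam h,
    Submodule.mem_orthogonal]
  constructor
  · intro hv
    rw [← inner_self_eq_zero (𝕜 := ℂ), ← hp.inner_apply_left, hp.apply_apply]
    exact hv _ ⟨v, rfl⟩
  · rintro hv _ ⟨u, rfl⟩
    change ⟪M.P.proj _ u, v⟫_ℂ = 0
    rw [hp.inner_apply_left, hv, inner_zero_right]

/-- A point of the support of the eigenspace `L_lam` in an open set `U` yields a nonzero vector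
of `L_lam` in the range of `P(U ∖ A_lam)`. -/
theorem exists_proj_mem_sqEigenspace (M : SpectralGeometry X) {lam : ℂ}
    (h : Module.End.HasEigenvalue (M.ds : Module.End ℂ M.H) lam) {U : Set (X × X)} (hU : IsOpen U)
    {b : X × X} (hbU : b ∈ U) (hb : b ∉ spectralNullSet M.P M.ds lam) :
    ∃ w : M.H, M.P.proj (U \ spectralNullSet M.P M.ds lam) w ∈ sqEigenspace M.ds lam ∧
      M.P.proj (U \ spectralNullSet M.P M.ds lam) w ≠ 0 := by
  let _ := borel (X × X)
  set A := spectralNullSet M.P M.ds lam with hA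
  have hAm : MeasurableSet[borel (X × X)] A := (M.isOpen_spectralNullSet lam).measurableSet_borel
  have hUm : MeasurableSet[borel (X × X)] U := hU.measurableSet_borel
  have hnot : ¬ (LinearMap.range (M.P.proj U : M.H →ₗ[ℂ] M.H)) ⟂ sqEigenspace M.ds lam :=
    fun ho => hb (mem_sUnion.2 ⟨U, ⟨hU, ho⟩, hbU⟩)
  rw [Submodule.isOrtho_iff_inner_eq] at hnot
  push Not at hnot
  obtain ⟨_, ⟨ξ, rfl⟩, w, hw, hne⟩ := hnot
  have hUw : M.P.proj U w ≠ 0 := by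
    intro h0
    apply hne
    change ⟪M.P.proj U ξ, w⟫_ℂ = 0
    rw [(M.P.isStarProjection_proj U hUm).inner_apply_left, h0, inner_zero_right]
  -- The projector `P(A_lam)` kills `P(U ∖ A_lam)w` by disjointness, which puts this vector in
  -- `L_lam`. It also kills `w`, so `P(U ∩ A_lam)w = 0` and `P(U ∖ A_lam)w` has the full norm of
  -- `P(U)w`.
  refine ⟨w, ?_, fun h0 => hUw ?_⟩
  · rw [M.mem_sqEigenspace_iff h]
    exact M.P.proj_apply_proj_of_disjoint w (hUm.diff hAm) hAm disjoint_sdiff_left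
  · have h1 := M.P.norm_sq_proj_union w (hUm.inter hAm) (hUm.diff hAm)
      (disjoint_sdiff_right.mono_left inter_subset_right)
    have h2 := M.P.norm_sq_proj_mono w (hUm.inter hAm) hAm inter_subset_right
    rw [(M.mem_sqEigenspace_iff h).1 hw] at h2
    rw [inter_union_sdiff, h0] at h1
    have h3 : ‖M.P.proj U w‖ ^ 2 = 0 := by
      refine le_antisymm ?_ (by positivity)
      simp only [norm_zero] at h1 h2
      linarith
    simpa using h3

theorem exists_forall_le_absEigenvalue {n : ℕ} (hn : 0 < n) [Nonempty X]
    (hX : LocallyBilipschitz n X) :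
    ∃ D : ℝ≥0, ∀ M : SpectralGeometry X, D < M.localDensity →
      ∃ c > 0, ∃ m₀ : ℕ, ∀ m ≥ m₀, ∀ i < m ^ n, c / m ≤ absEigenvalue M.ds i := by
  obtain ⟨c, hc, C, hC, hgrid⟩ := hX.exists_grid hn
  -- Density above `8C/c` puts a support point within `(C/m) / (8C/c) = c/(8m)` of each grid pair.
  refine ⟨(8 * C / c).toNNReal, fun M hM => ⟨c / 2, by positivity, ?_⟩⟩
  simp only [SpectralGeometry.localDensity, _root_.localDensity, lt_iSup_iff] at hM
  obtain ⟨t, ht, hDt⟩ := hM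
  have ht0 : 0 < t := ht
  obtain ⟨m₁, hm₁⟩ := exists_nat_ge (C / t)
  refine ⟨m₁ + 1, fun m hm i hi => ?_⟩
  have hm0 : 0 < m := by omega
  have hmR : (0 : ℝ) < m := by exact_mod_cast hm0
  obtain ⟨x, y, hsep, hxy⟩ := hgrid m hm0
  have hCt : C / m ≤ t := by
    rw [div_le_iff₀ hmR, ← div_le_iff₀' ht0]
    exact hm₁.trans (by exact_mod_cast (by omega : m₁ ≤ m))
  have hcm : 0 < c / m := by positivity
  have hb : ∀ a, ∃ b ∈ M.support, dist (x a, y a) b ≤ c / m / 8 := by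
    intro a
    have hne : x a ≠ y a := dist_pos.1 (hcm.trans_le (hxy a).1)
    have h1 := hDt.trans_le (iInf₂_le (x a, y a) ⟨hne, (hxy a).2.trans hCt⟩)
    simp only [lt_iSup_iff] at h1
    obtain ⟨b, hbM, hb⟩ := h1
    refine ⟨b, hbM, ?_⟩
    have h2 := ENNReal.mul_le_of_le_div hb.le
    rw [edist_nndist, edist_nndist, ← ENNReal.coe_mul, ENNReal.coe_le_coe,
      ← NNReal.coe_le_coe] at h2
    rw [NNReal.coe_mul, Real.coe_toNNReal _ (by positivity), coe_nndist, coe_nndist] at h2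
    have h3 := h2.trans (hxy a).2
    rw [← le_div_iff₀' (by positivity)] at h3
    refine h3.trans_eq ?_
    field_simp
  choose b hbM hbd using hb
  simp only [support, mem_iUnion, mem_compl_iff] at hbM
  choose lam hlam hbnull using hbM
  -- The radius `c/(4m)` exceeds `c/(8m)`, so `b a` lies inside, and is small enough for the balls
  -- to be disjoint, the points `x a` being `c/m` apart.
  let U : (Fin n → Fin m) → Set (X × X) := fun a => Metric.ball (x a, y a) (c / m / 4)
  have hbU : ∀ a, b a ∈ U a := fun a => by
    rw [Metric.mem_ball, dist_comm]
    exact (hbd a).trans_lt (by linarith)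
  choose w hw hw0 using fun a =>
    M.exists_proj_mem_sqEigenspace (hlam a) Metric.isOpen_ball (hbU a) (hbnull a)
  have hmeas : ∀ a, MeasurableSet[borel (X × X)] (U a \ spectralNullSet M.P M.ds (lam a)) := by
    intro a
    let _ := borel (X × X)
    exact (MeasurableSet.diff Metric.isOpen_ball.measurableSet_borel
      (M.isOpen_spectralNullSet (lam a)).measurableSet_borel)
  rw [div_right_comm]
  refine le_absEigenvalue (by positivity) (fun a => M.P.proj (U a \ _) (w a)) (fun a => ?_) hw0
    (fun a a' haa' => ?_) (by simpa using hi)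
  · have h1 : c / m / 2 ≤ ‖lam a‖ := by
      rw [← M.dist_eq (lam a) (hlam a) (b a) (hbnull a)]
      have h2 := hbd a
      rw [Prod.dist_eq] at h2
      have h3 := (le_max_left _ _).trans h2
      have h4 := (le_max_right _ _).trans h2
      have h5 := (hxy a).1
      have h6 : dist (x a) (y a) ≤ dist (x a) (b a).1 + dist (b a).1 (b a).2 +
          dist (y a) (b a).2 := by
        rw [dist_comm (y a)]
        exact dist_triangle4 _ _ _ _
      simp only at h3 h4
      linarith
    refine (le_biSup (fun s : ℝ => sqEigenspace M.ds (s : ℂ)) h1) ?_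
    rw [M.sqEigenspace_norm (hlam a)]
    exact hw a
  · refine M.P.inner_proj_proj_of_disjoint _ _ (hmeas a) (hmeas a') ?_
    refine Disjoint.mono sdiff_le sdiff_le (Metric.ball_disjoint_ball ?_)
    have h1 := hsep a a' haa'
    have h2 : dist (x a) (x a') ≤ dist (x a, y a) (x a', y a') := by
      rw [Prod.dist_eq]
      exact le_max_left _ _
    linarith

end SpectralGeometry

/-! ### Weighted permutation operators on `ℓ²` -/

section WeightedPerm

variable {S : Type*}

theorem lp_two_summable_norm_sq (ξ : lp (fun _ : S => ℂ) 2) : Summable fun s => ‖ξ s‖ ^ 2 := by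
  have h := (lp.memℓp ξ).summable (by simp)
  simpa using h

theorem lp_two_norm_sq (ξ : lp (fun _ : S => ℂ) 2) : ‖ξ‖ ^ 2 = ∑' s, ‖ξ s‖ ^ 2 := by
  have h := lp.norm_rpow_eq_tsum (p := 2) (by simp) ξ
  simpa using h

theorem memℓp_weightedPerm {w : S → ℂ} {C : ℝ} (hw : ∀ s, ‖w s‖ ≤ C) (σ : Equiv.Perm S)
    (ξ : lp (fun _ : S => ℂ) 2) : Memℓp (fun s => w s * ξ (σ s)) 2 := by
  refine memℓp_gen ?_
  have h := (σ.summable_iff.2 (lp_two_summable_norm_sq ξ)).mul_left (C ^ 2)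
  refine Summable.of_nonneg_of_le (fun s => by positivity) (fun s => ?_) h
  simp only [ENNReal.toReal_ofNat, Real.rpow_ofNat, Function.comp_apply, norm_mul, mul_pow]
  have := hw s
  gcongr

theorem lp_two_norm_le_of_eq_mul {w : S → ℂ} {C : ℝ} (hC : 0 ≤ C) (hw : ∀ s, ‖w s‖ ≤ C)
    (σ : Equiv.Perm S) {ξ η : lp (fun _ : S => ℂ) 2} (h : ∀ s, η s = w s * ξ (σ s)) :
    ‖η‖ ≤ C * ‖ξ‖ := by
  refine le_of_sq_le_sq ?_ (by positivity)
  rw [mul_pow, lp_two_norm_sq, lp_two_norm_sq, ← σ.tsum_eq (fun s => ‖ξ s‖ ^ 2), ← tsum_mul_left]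
  refine Summable.tsum_le_tsum (fun s => ?_) (lp_two_summable_norm_sq _)
    ((σ.summable_iff.2 (lp_two_summable_norm_sq ξ)).mul_left _)
  rw [h s, norm_mul, mul_pow]
  have := hw s
  gcongr

/-- The linear map `ξ ↦ (s ↦ w s * ξ (σ s))` on `ℓ²`. -/
def weightedPermLinear (w : S → ℂ) (C : ℝ) (hw : ∀ s, ‖w s‖ ≤ C) (σ : Equiv.Perm S) :
    lp (fun _ : S => ℂ) 2 →ₗ[ℂ] lp (fun _ : S => ℂ) 2 where
  toFun ξ := ⟨fun s => w s * ξ (σ s), memℓp_weightedPerm hw σ ξ⟩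
  map_add' _ _ := lp.ext (funext fun _ => mul_add _ _ _)
  map_smul' _ _ := lp.ext (funext fun _ => mul_left_comm _ _ _)

open scoped Classical in
/-- The operator `ξ ↦ (s ↦ w s * ξ (σ s))` on `ℓ²`, for a bounded weight `w` and a
permutation `σ` (and `0` if `w` is unbounded). -/
def weightedPerm (w : S → ℂ) (σ : Equiv.Perm S) :
    lp (fun _ : S => ℂ) 2 →L[ℂ] lp (fun _ : S => ℂ) 2 :=
  if h : ∃ C, 0 ≤ C ∧ ∀ s, ‖w s‖ ≤ C then
    (weightedPermLinear w h.choose h.choose_spec.2 σ).mkContinuous h.choose fun _ =>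
      lp_two_norm_le_of_eq_mul h.choose_spec.1 h.choose_spec.2 σ fun _ => rfl
  else 0

theorem weightedPerm_apply {w : S → ℂ} {C : ℝ} (hC : 0 ≤ C) (hw : ∀ s, ‖w s‖ ≤ C)
    (σ : Equiv.Perm S) (ξ : lp (fun _ : S => ℂ) 2) (s : S) :
    weightedPerm w σ ξ s = w s * ξ (σ s) := by
  rw [weightedPerm, dif_pos ⟨C, hC, hw⟩]
  rfl

theorem norm_weightedPerm_le {w : S → ℂ} {C : ℝ} (hC : 0 ≤ C) (hw : ∀ s, ‖w s‖ ≤ C)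
    (σ : Equiv.Perm S) : ‖weightedPerm w σ‖ ≤ C := by
  refine ContinuousLinearMap.opNorm_le_bound _ hC fun ξ => ?_
  exact lp_two_norm_le_of_eq_mul hC hw σ fun s => weightedPerm_apply hC hw σ ξ s

theorem star_weightedPerm {w : S → ℂ} {C : ℝ} (hC : 0 ≤ C) (hw : ∀ s, ‖w s‖ ≤ C)
    (σ : Equiv.Perm S) :
    star (weightedPerm w σ) = weightedPerm (fun s => star (w (σ.symm s))) σ.symm := by
  rw [ContinuousLinearMap.star_eq_adjoint]
  symm
  rw [ContinuousLinearMap.eq_adjoint_iff]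
  intro ξ η
  rw [lp.inner_eq_tsum, lp.inner_eq_tsum, ← σ.tsum_eq]
  refine tsum_congr fun s => ?_
  rw [weightedPerm_apply hC hw, weightedPerm_apply hC (fun s => by simpa using hw (σ.symm s))]
  simp only [Equiv.symm_apply_apply, RCLike.inner_apply, map_mul, RCLike.star_def,
    RingHomCompTriple.comp_apply, RingHom.id_apply]
  ring

/-- Truncating the weight to a finite set gives a finite-rank operator; the error is again a
weighted permutation, of norm at most the bound for the remaining weights. -/
theorem isCompactOperator_weightedPerm {w : S → ℂ} (hw : Tendsto (fun s => ‖w s‖) cofinite (𝓝 0))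
    {C : ℝ} (hC : 0 ≤ C) (hwC : ∀ s, ‖w s‖ ≤ C) (σ : Equiv.Perm S) :
    IsCompactOperator (weightedPerm w σ) := by
  classical
  let e : S → lp (fun _ : S => ℂ) 2 := fun s => lp.single 2 s (w s)
  let K : S → lp (fun _ : S => ℂ) 2 →L[ℂ] lp (fun _ : S => ℂ) 2 := fun s =>
    (ContinuousLinearMap.toSpanSingleton ℂ (e s)) ∘L
      (lp.evalCLM ℂ (fun _ : S => ℂ) 2 (σ s))
  have hK : ∀ s, IsCompactOperator (K s) := fun s =>
    (isCompactOperator_of_locallyCompactSpace_dom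
      (lp.evalCLM ℂ (fun _ : S => ℂ) 2 (σ s))).clm_comp
      (ContinuousLinearMap.toSpanSingleton ℂ (e s))
  have hKsum : ∀ F : Finset S, IsCompactOperator ⇑(∑ s ∈ F, K s) := by
    intro F
    induction F using Finset.induction_on with
    | empty => exact isCompactOperator_zero
    | insert s F hs ih =>
      rw [Finset.sum_insert hs]
      exact (hK s).add ih
  refine isCompactOperator_of_tendsto (l := atTop) (F := fun F : Finset S => ∑ s ∈ F, K s) ?_
    (Eventually.of_forall hKsum)
  rw [Metric.tendsto_atTop]
  intro ε hε
  have hfin : {s | ¬ ‖w s‖ < ε / 2}.Finite := hw.eventually (gt_mem_nhds (half_pos hε))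
  refine ⟨hfin.toFinset, fun F hF => ?_⟩
  have heq : ∑ s ∈ F, K s - weightedPerm w σ =
      weightedPerm (fun s => if s ∈ F then 0 else - w s) σ := by
    ext ξ s
    have hbd : ∀ s, ‖if s ∈ F then 0 else - w s‖ ≤ C := by
      intro s
      split_ifs
      · simpa using hC
      · simpa using hwC s
    have hsum : ((∑ s ∈ F, K s) ξ) s = if s ∈ F then w s * ξ (σ s) else 0 := by
      rw [_root_.sum_apply, lp.coeFn_sum, Finset.sum_apply]
      have : ∀ t, K t ξ s = if s = t then w s * ξ (σ s) else 0 := by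
        intro t
        change (ξ (σ t) • lp.single 2 t (w t) : lp (fun _ : S => ℂ) 2) s = _
        rw [lp.coeFn_smul, Pi.smul_apply, lp.single_apply, Pi.single_apply]
        split_ifs with h
        · subst h
          simp [mul_comm]
        · simp
      simp [this]
    rw [_root_.sub_apply, lp.coeFn_sub, Pi.sub_apply, hsum,
      weightedPerm_apply hC hwC, weightedPerm_apply hC hbd]
    split_ifs <;> simp
  rw [dist_eq_norm, heq]
  refine (norm_weightedPerm_le (half_pos hε).le (fun s => ?_) σ).trans_lt (half_lt_self hε)
  split_ifs with h
  · simpa using (half_pos hε).le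
  · have : s ∉ hfin.toFinset := fun h' => h (hF h')
    simp only [Finite.mem_toFinset, mem_ofPred_eq, not_not] at this
    simpa using this.le

end WeightedPerm

/-! ### Atomic spectral measures -/

section Atomic

variable {T : Type*} (S : Set T)

/-- Multiplication by the indicator function of `A` on `ℓ²(S)`. -/
def atomicProj (A : Set T) : lp (fun _ : S => ℂ) 2 →L[ℂ] lp (fun _ : S => ℂ) 2 :=
  weightedPerm (fun s => A.indicator 1 (s : T)) 1

open scoped Classical in
theorem atomicProj_apply (A : Set T) (ξ : lp (fun _ : S => ℂ) 2) (s : S) :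
    atomicProj S A ξ s = if (s : T) ∈ A then ξ s else 0 := by
  rw [atomicProj, weightedPerm_apply zero_le_one]
  · by_cases h : (s : T) ∈ A <;> simp [h]
  · intro s
    by_cases h : (s : T) ∈ A <;> simp [h]

theorem isStarProjection_atomicProj (A : Set T) : IsStarProjection (atomicProj S A) := by
  classical
  constructor
  · rw [IsIdempotentElem]
    ext ξ s
    rw [mul_apply_eq_comp, atomicProj_apply, atomicProj_apply]
    split_ifs <;> rfl
  · rw [IsSelfAdjoint, atomicProj, star_weightedPerm zero_le_one]
    · congr 1
      ext s
      change star (A.indicator (1 : T → ℂ) s) = A.indicator 1 (s : T)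
      by_cases h : (s : T) ∈ A <;> simp [h]
    · intro s
      by_cases h : (s : T) ∈ A <;> simp [h]

variable [TopologicalSpace T]

theorem weightedPerm_restrict_apply [CompactSpace T] (a : C(T, ℂ)) (ξ : lp (fun _ : S => ℂ) 2)
    (s : S) : weightedPerm (fun s : S => a s) 1 ξ s = a s * ξ s :=
  weightedPerm_apply (norm_nonneg a) (fun s : S => a.norm_coe_le_norm s) 1 ξ s

/-- The representation of `C(T)` on `ℓ²(S)` by multiplication. -/
def atomicRep [CompactSpace T] :
    C(T, ℂ) →⋆ₐ[ℂ] (lp (fun _ : S => ℂ) 2 →L[ℂ] lp (fun _ : S => ℂ) 2) where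
  toFun a := weightedPerm (fun s => a s) 1
  map_one' := by
    ext ξ s
    rw [weightedPerm_restrict_apply]
    simp
  map_mul' a b := by
    ext ξ s
    rw [weightedPerm_restrict_apply, mul_apply_eq_comp, weightedPerm_restrict_apply,
      weightedPerm_restrict_apply, ContinuousMap.mul_apply, mul_assoc]
  map_zero' := by
    ext ξ s
    rw [weightedPerm_restrict_apply]
    simp
  map_add' a b := by
    ext ξ s
    change _ = weightedPerm (fun s : S => a s) 1 ξ s + weightedPerm (fun s : S => b s) 1 ξ s
    rw [weightedPerm_restrict_apply, weightedPerm_restrict_apply, weightedPerm_restrict_apply]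
    exact add_mul _ _ _
  commutes' r := by
    ext ξ s
    rw [weightedPerm_restrict_apply]
    simp [Algebra.algebraMap_eq_smul_one]
  map_star' a := by
    rw [star_weightedPerm (norm_nonneg a) fun s : S => a.norm_coe_le_norm s]
    rfl

theorem atomicRep_apply [CompactSpace T] (a : C(T, ℂ)) (ξ : lp (fun _ : S => ℂ) 2) (s : S) :
    atomicRep S a ξ s = a s * ξ s :=
  weightedPerm_restrict_apply S a ξ s

/-- The spectral measure on `ℓ²(S)` given by multiplication by indicator functions. -/
def atomicSpectralMeasure : SpectralMeasure T (lp (fun _ : S => ℂ) 2) where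
  proj := atomicProj S
  isStarProjection_proj A _ := isStarProjection_atomicProj S A
  measure ξ := @Measure.sum T S (borel T) fun s =>
    ENNReal.ofReal (‖ξ s‖ ^ 2) • @Measure.dirac T (borel T) s
  measure_apply ξ A hA := by
    classical
    let _ := borel T
    rw [(isStarProjection_atomicProj S A).re_inner_apply_self, lp_two_norm_sq,
      ENNReal.ofReal_tsum_of_nonneg (fun s => by positivity) (lp_two_summable_norm_sq _),
      Measure.sum_apply _ hA]
    refine tsum_congr fun s => ?_
    rw [Measure.smul_apply, Measure.dirac_apply' _ hA, atomicProj_apply]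
    by_cases h : (s : T) ∈ A <;> simp [h]

theorem atomicSpectralMeasure_represents [CompactSpace T] :
    (atomicSpectralMeasure S).Represents (atomicRep S) := by
  intro a ξ
  let _ := borel T
  have : BorelSpace T := ⟨rfl⟩
  have hfin : IsFiniteMeasure ((atomicSpectralMeasure S).measure ξ) :=
    ⟨by rw [SpectralMeasure.measure_apply _ ξ univ MeasurableSet.univ]; exact ENNReal.ofReal_lt_top⟩
  have hmeas : StronglyMeasurable fun z => a z := a.continuous.measurable.stronglyMeasurable
  have hint : Integrable (fun z => a z) ((atomicSpectralMeasure S).measure ξ) :=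
    Integrable.of_bound hmeas.aestronglyMeasurable ‖a‖
      (Eventually.of_forall fun z => a.norm_coe_le_norm z)
  -- The measure is a sum of point masses `‖ξ s‖²`, so both sides are sums over `S` and agree term
  -- by term.
  have h1 := hasSum_integral_measure hint
  refine (lp.hasSum_inner ξ (atomicRep S a ξ)).unique (h1.congr_fun ?_)
  intro s
  rw [integral_smul_measure, integral_dirac' _ _ hmeas, atomicRep_apply,
    ENNReal.toReal_ofReal (by positivity), RCLike.inner_apply, Complex.real_smul]
  push_cast
  rw [← Complex.mul_conj']
  ring

end Atomic

/-! ### The atomic spectral geometry of a symmetric set of pairs -/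

section AtomicGeometry

variable {X : Type*} [MetricSpace X] {S : Set (X × X)}

/-- The exchange of coordinates on a symmetric set of pairs. -/
def swapPerm (hsymm : ∀ z ∈ S, z.swap ∈ S) : Equiv.Perm S where
  toFun s := ⟨s.1.swap, hsymm _ s.2⟩
  invFun s := ⟨s.1.swap, hsymm _ s.2⟩
  left_inv s := by simp
  right_inv s := by simp

/-- The unit length `e_(x, y) ↦ |xy| e_(y, x)` on `ℓ²(S)`. -/
def atomicLength (hsymm : ∀ z ∈ S, z.swap ∈ S) :
    lp (fun _ : S => ℂ) 2 →L[ℂ] lp (fun _ : S => ℂ) 2 :=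
  weightedPerm (fun s => ((dist s.1.1 s.1.2 : ℝ) : ℂ)) (swapPerm hsymm)

/-- Finiteness makes the set of pairs of a given length closed, as needed to find `A_lam`. -/
theorem finite_dist_eq (hS : Tendsto (fun s : S => dist s.1.1 s.1.2) cofinite (𝓝 0))
    (hne : ∀ z ∈ S, z.1 ≠ z.2) (r : ℝ) : {z : X × X | z ∈ S ∧ dist z.1 z.2 = r}.Finite := by
  rcases le_or_gt r 0 with hr | hr
  · convert! Set.finite_empty
    ext z
    simp only [mem_ofPred_eq, mem_empty_iff_false, iff_false, not_and]
    intro hz hzr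
    have := dist_pos.2 (hne z hz)
    linarith
  · have h : {s : S | ¬ dist s.1.1 s.1.2 < r}.Finite := hS.eventually (gt_mem_nhds hr)
    refine (h.image Subtype.val).subset ?_
    rintro z ⟨hz, hzr⟩
    exact ⟨⟨z, hz⟩, by simp [hzr], rfl⟩

theorem localDensity_mono {B B' : Set (X × X)} (h : B ⊆ B') : localDensity B ≤ localDensity B' :=
  iSup₂_mono fun _ _ => iInf₂_mono fun _ _ => biSup_mono fun _ hb => h hb

variable [CompactSpace X] (hsymm : ∀ z ∈ S, z.swap ∈ S)

theorem norm_dist_le_diam (s : S) :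
    ‖((dist s.1.1 s.1.2 : ℝ) : ℂ)‖ ≤ Metric.diam (univ : Set X) := by
  rw [Complex.norm_real, Real.norm_of_nonneg dist_nonneg]
  exact Metric.dist_le_diam_of_mem isCompact_univ.isBounded (mem_univ _) (mem_univ _)

theorem atomicLength_apply (ξ : lp (fun _ : S => ℂ) 2) (s : S) :
    atomicLength hsymm ξ s = ((dist s.1.1 s.1.2 : ℝ) : ℂ) * ξ (swapPerm hsymm s) :=
  weightedPerm_apply Metric.diam_nonneg norm_dist_le_diam _ ξ s

theorem atomicLength_atomicLength_apply (ξ : lp (fun _ : S => ℂ) 2) (s : S) :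
    atomicLength hsymm (atomicLength hsymm ξ) s = ((dist s.1.1 s.1.2 : ℝ) : ℂ) ^ 2 * ξ s := by
  rw [atomicLength_apply, atomicLength_apply]
  have h1 : swapPerm hsymm (swapPerm hsymm s) = s := (swapPerm hsymm).left_inv s
  have h2 : dist (swapPerm hsymm s).1.1 (swapPerm hsymm s).1.2 = dist s.1.1 s.1.2 := dist_comm _ _
  rw [h1, h2]
  ring

/-- The square of the length operator is multiplication by `|s|²`, and `r ≥ 0` allows square roots
to be taken. -/
theorem mem_sqEigenspace_atomicLength {r : ℝ} (hr : 0 ≤ r) {ξ : lp (fun _ : S => ℂ) 2} :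
    ξ ∈ sqEigenspace (atomicLength hsymm) (r : ℂ) ↔ ∀ s, ξ s ≠ 0 → dist s.1.1 s.1.2 = r := by
  rw [mem_sqEigenspace]
  constructor
  · intro h s hs
    have h1 := congr($h s)
    rw [atomicLength_atomicLength_apply, lp.coeFn_smul, Pi.smul_apply, smul_eq_mul] at h1
    have h2 := mul_right_cancel₀ hs h1
    have h3 : dist s.1.1 s.1.2 ^ 2 = r ^ 2 := Complex.ofReal_injective (by push_cast; exact h2)
    exact (pow_left_inj₀ dist_nonneg hr two_ne_zero).1 h3
  · intro h
    ext s
    rw [atomicLength_atomicLength_apply, lp.coeFn_smul, Pi.smul_apply, smul_eq_mul]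
    by_cases hs : ξ s = 0
    · simp [hs]
    · rw [h s hs]

theorem sqEigenspace_atomicLength_of_hasEigenvalue {lam : ℂ}
    (h : Module.End.HasEigenvalue
      (atomicLength hsymm : Module.End ℂ (lp (fun _ : S => ℂ) 2)) lam) :
    sqEigenspace (atomicLength hsymm) lam = sqEigenspace (atomicLength hsymm) ((‖lam‖ : ℝ) : ℂ) := by
  obtain ⟨v, hv⟩ := h.exists_hasEigenvector
  have h1 : atomicLength hsymm v = lam • v := hv.apply_eq_smul
  have h2 : atomicLength hsymm (atomicLength hsymm v) = lam ^ 2 • v := by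
    rw [h1, map_smul, h1, smul_smul, sq]
  obtain ⟨s, hs⟩ : ∃ s, v s ≠ 0 := by
    by_contra! h0
    exact hv.2 (lp.ext (funext h0))
  have h3 := congr($h2 s)
  rw [atomicLength_atomicLength_apply, lp.coeFn_smul, Pi.smul_apply, smul_eq_mul] at h3
  have h4 := mul_right_cancel₀ hs h3
  have h5 : ((‖lam‖ : ℝ) : ℂ) ^ 2 = lam ^ 2 := by
    have h6 : dist s.1.1 s.1.2 ^ 2 = ‖lam‖ ^ 2 := by
      rw [← norm_pow, ← h4]
      simp
    rw [← h4]
    exact_mod_cast h6.symm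
  rw [sqEigenspace, sqEigenspace, h5]

/-- An open set containing a pair `z` of length `|lam|` is not null, since its projector fixes
`e_z`, which lies in `L_lam`. Conversely the complement of all such pairs is open and its projector
is orthogonal to `L_lam`. -/
theorem spectralNullSet_atomic (hS : Tendsto (fun s : S => dist s.1.1 s.1.2) cofinite (𝓝 0))
    (hne : ∀ z ∈ S, z.1 ≠ z.2) {lam : ℂ}
    (h : Module.End.HasEigenvalue
      (atomicLength hsymm : Module.End ℂ (lp (fun _ : S => ℂ) 2)) lam) :
    spectralNullSet (atomicSpectralMeasure S) (atomicLength hsymm) lam =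
      {z : X × X | z ∈ S ∧ dist z.1 z.2 = ‖lam‖}ᶜ := by
  classical
  rw [spectralNullSet, sqEigenspace_atomicLength_of_hasEigenvalue hsymm h]
  apply Subset.antisymm
  · rintro z ⟨A, ⟨-, hA⟩, hzA⟩ ⟨hzS, hz⟩
    let e : lp (fun _ : S => ℂ) 2 := lp.single 2 ⟨z, hzS⟩ 1
    have h1 : e ∈ sqEigenspace (atomicLength hsymm) ((‖lam‖ : ℝ) : ℂ) := by
      rw [mem_sqEigenspace_atomicLength hsymm (norm_nonneg _)]
      intro s hs
      by_cases hsz : s = ⟨z, hzS⟩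
      · rw [hsz]; exact hz
      · exact absurd (lp.single_apply_ne 2 _ _ hsz) hs
    have h2 : (atomicSpectralMeasure S).proj A e = e := by
      change atomicProj S A e = e
      ext s
      rw [atomicProj_apply]
      by_cases hsz : s = ⟨z, hzS⟩
      · rw [hsz, if_pos hzA]
      · split_ifs
        · rfl
        · exact (lp.single_apply_ne (E := fun _ : S => ℂ) 2 _ _ hsz).symm
    have h3 : ⟪e, e⟫_ℂ = 0 := Submodule.isOrtho_iff_inner_eq.1 hA e ⟨e, h2⟩ e h1
    rw [inner_self_eq_zero] at h3
    have h4 : e ⟨z, hzS⟩ = 0 := by rw [h3]; rfl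
    simp [e] at h4
  · refine subset_sUnion_of_mem ⟨(finite_dist_eq hS hne _).isClosed.isOpen_compl, ?_⟩
    rw [Submodule.isOrtho_iff_inner_eq]
    rintro _ ⟨ξ, rfl⟩ v hv
    rw [mem_sqEigenspace_atomicLength hsymm (norm_nonneg _)] at hv
    change ⟪atomicProj S _ ξ, v⟫_ℂ = 0
    rw [lp.inner_eq_tsum]
    refine (tsum_congr fun s => ?_).trans tsum_zero
    rw [atomicProj_apply]
    by_cases hs : v s = 0
    · simp [hs]
    · rw [if_neg, inner_zero_left]
      exact fun hmem => hmem ⟨s.2, hv s hs⟩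

/-- The spectral geometry on `ℓ²(S)`, for a symmetric set `S` of pairs of distinct points whose
lengths tend to `0`. -/
def atomicGeometry (hS : Tendsto (fun s : S => dist s.1.1 s.1.2) cofinite (𝓝 0))
    (hne : ∀ z ∈ S, z.1 ≠ z.2) : SpectralGeometry X where
  H := lp (fun _ : S => ℂ) 2
  rep :=
    { toFun := fun a => atomicRep S (pullbackFst (a : C(X, ℂ)))
      map_one' := map_one (atomicRep S)
      map_mul' := fun a b => map_mul (atomicRep S) (pullbackFst (a : C(X, ℂ))) (pullbackFst b)
      map_zero' := map_zero (atomicRep S)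
      map_add' := fun a b => map_add (atomicRep S) (pullbackFst (a : C(X, ℂ))) (pullbackFst b)
      commutes' := fun r => AlgHomClass.commutes (atomicRep S) r
      map_star' := fun a => map_star (atomicRep S) (pullbackFst (a : C(X, ℂ))) }
  ds := atomicLength hsymm
  injective_ds := by
    rw [injective_iff_map_eq_zero]
    intro ξ hξ
    ext s
    have h1 := congr($hξ (swapPerm hsymm s))
    rw [atomicLength_apply] at h1
    have h2 : swapPerm hsymm (swapPerm hsymm s) = s := (swapPerm hsymm).left_inv s
    have h3 : dist (swapPerm hsymm s).1.1 (swapPerm hsymm s).1.2 ≠ 0 :=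
      (dist_pos.2 (hne _ (swapPerm hsymm s).2)).ne'
    rw [h2] at h1
    exact (mul_eq_zero.1 h1).resolve_left (Complex.ofReal_ne_zero.2 h3)
  isCompactOperator_ds := by
    refine isCompactOperator_weightedPerm ?_ Metric.diam_nonneg norm_dist_le_diam _
    simpa using hS
  isSelfAdjoint_ds := by
    rw [IsSelfAdjoint, atomicLength, star_weightedPerm Metric.diam_nonneg norm_dist_le_diam]
    have h1 : (swapPerm hsymm).symm = swapPerm hsymm := rfl
    rw [h1]
    congr 1
    ext s
    rw [RCLike.star_def, Complex.conj_ofReal]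
    exact congrArg _ (dist_comm _ _)
  extRep := atomicRep S
  rep_eq _ := rfl
  P := atomicSpectralMeasure S
  represents := atomicSpectralMeasure_represents S
  ds_comp_proj A _ := by
    classical
    ext ξ s
    change atomicLength hsymm (atomicProj S A ξ) s =
      atomicProj S (Prod.swap '' A) (atomicLength hsymm ξ) s
    rw [atomicLength_apply, atomicProj_apply, atomicProj_apply, atomicLength_apply]
    have h : ((swapPerm hsymm s : S) : X × X) ∈ A ↔ (s : X × X) ∈ Prod.swap '' A := by
      rw [image_swap_eq_preimage_swap]
      rfl
    by_cases hs : (s : X × X) ∈ Prod.swap '' A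
    · rw [if_pos hs, if_pos (h.2 hs)]
    · rw [if_neg hs, if_neg (mt h.1 hs), mul_zero]
  range_proj lam h := by
    classical
    rw [spectralNullSet_atomic hsymm hS hne h, sqEigenspace_atomicLength_of_hasEigenvalue hsymm h]
    apply le_antisymm
    · rintro _ ⟨ξ, rfl⟩
      rw [Submodule.mem_orthogonal']
      intro v hv
      rw [mem_sqEigenspace_atomicLength hsymm (norm_nonneg _)] at hv
      change ⟪atomicProj S _ ξ, v⟫_ℂ = 0
      rw [lp.inner_eq_tsum]
      refine (tsum_congr fun s => ?_).trans tsum_zero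
      rw [atomicProj_apply]
      by_cases hs : v s = 0
      · simp [hs]
      · rw [if_neg, inner_zero_left]
        exact fun hmem => hmem ⟨s.2, hv s hs⟩
    · intro η hη
      refine ⟨η, ?_⟩
      change atomicProj S _ η = η
      ext s
      rw [atomicProj_apply]
      split_ifs with hs
      · rfl
      · simp only [mem_compl_iff, not_not, mem_ofPred_eq] at hs
        have h1 : (lp.single 2 s 1 : lp (fun _ : S => ℂ) 2) ∈
            sqEigenspace (atomicLength hsymm) ((‖lam‖ : ℝ) : ℂ) := by
          rw [mem_sqEigenspace_atomicLength hsymm (norm_nonneg _)]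
          intro t ht
          by_cases hst : t = s
          · rw [hst]; exact hs.2
          · exact absurd (lp.single_apply_ne 2 _ _ hst) ht
        have h2 := (Submodule.mem_orthogonal _ _).1 hη _ h1
        rw [lp.inner_single_left] at h2
        simpa using h2.symm
  dist_eq lam h z hz := by
    rw [spectralNullSet_atomic hsymm hS hne h, mem_compl_iff, not_not] at hz
    exact hz.2

/-- For `(x, y)` in `S` the vector `e_(x,y) + e_(y,x)` is an eigenvector for `|xy|`, nonzero because
`x ≠ y`. -/
theorem subset_support_atomicGeometry
    (hS : Tendsto (fun s : S => dist s.1.1 s.1.2) cofinite (𝓝 0)) (hne : ∀ z ∈ S, z.1 ≠ z.2) :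
    S ⊆ (atomicGeometry hsymm hS hne).support := by
  classical
  intro z hz
  let e : S → lp (fun _ : S => ℂ) 2 := fun s => lp.single 2 s 1
  let s : S := ⟨z, hz⟩
  have hswap : swapPerm hsymm (swapPerm hsymm s) = s := (swapPerm hsymm).left_inv s
  have hne' : s ≠ swapPerm hsymm s := by
    intro h
    exact hne z hz congr(($h).1.1)
  have heig : Module.End.HasEigenvalue
      (atomicLength hsymm : Module.End ℂ (lp (fun _ : S => ℂ) 2)) ((dist z.1 z.2 : ℝ) : ℂ) := by
    refine Module.End.hasEigenvalue_of_hasEigenvector (x := e s + e (swapPerm hsymm s)) ?_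
    rw [Module.End.hasEigenvector_iff, Module.End.mem_eigenspace_iff]
    constructor
    · change atomicLength hsymm _ = _
      ext t
      rw [atomicLength_apply]
      simp only [e, lp.coeFn_smul, lp.coeFn_add, Pi.smul_apply, Pi.add_apply, smul_eq_mul,
        lp.single_apply, Pi.single_apply]
      by_cases h1 : t = s
      · subst h1
        simp [hne', hne'.symm, s]
      · by_cases h2 : t = swapPerm hsymm s
        · subst h2
          rw [hswap]
          simp only [hne', hne'.symm, if_true, if_false, add_zero, zero_add, mul_one]
          exact congrArg _ (dist_comm _ _)
        · have h3 : swapPerm hsymm t ≠ s := fun h => h2 (by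
            rw [← h]; exact ((swapPerm hsymm).left_inv t).symm)
          have h4 : swapPerm hsymm t ≠ swapPerm hsymm s := fun h => h1 ((swapPerm hsymm).injective h)
          simp [h1, h2, h3, h4]
    · intro h0
      have h1 := congr($h0 s)
      simp [e, lp.single_apply, hne'] at h1
  refine mem_iUnion₂.2 ⟨_, heig, ?_⟩
  change z ∉ spectralNullSet (atomicSpectralMeasure S) (atomicLength hsymm) _
  rw [spectralNullSet_atomic hsymm hS hne heig, mem_compl_iff, not_not]
  exact ⟨hz, by simp⟩

/-- A Chebyshev estimate: the eigenspaces for values at least `t` are carried by the pairs of length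
at least `t`. If their total rank exceeds `i`, there are at least `i + 1` such pairs, so `(i + 1)
t^q` is at most the whole sum. -/
theorem absEigenvalue_atomicLength_le {q : ℝ} (hq : 0 < q)
    (hsum : Summable fun s : S => dist s.1.1 s.1.2 ^ q) (i : ℕ) :
    absEigenvalue (atomicLength hsymm) i ≤
      ((∑' s : S, dist s.1.1 s.1.2 ^ q) / (i + 1)) ^ (1 / q) := by
  classical
  have hC : 0 ≤ ∑' s : S, dist s.1.1 s.1.2 ^ q := tsum_nonneg fun s => by positivity
  refine Real.sSup_le ?_ (by positivity)
  rintro t ⟨ht, hrank⟩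
  have hfin : {s : S | t ≤ dist s.1.1 s.1.2}.Finite := by
    have h1 : {s : S | ¬ dist s.1.1 s.1.2 ^ q < t ^ q}.Finite :=
      hsum.tendsto_cofinite_zero.eventually (gt_mem_nhds (by positivity))
    refine h1.subset fun s hs => ?_
    simp only [mem_ofPred_eq, not_lt] at hs ⊢
    gcongr
  let F : Finset S := hfin.toFinset
  have hsupp : ∀ v ∈ absEigenspaceGE (atomicLength hsymm) t, ∀ s, s ∉ F → v s = 0 := by
    let V : Submodule ℂ (lp (fun _ : S => ℂ) 2) :=
      { carrier := {v | ∀ s, s ∉ F → v s = 0}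
        add_mem' := fun {a b} ha hb s hs => by
          rw [lp.coeFn_add, Pi.add_apply, ha s hs, hb s hs, add_zero]
        zero_mem' := fun s _ => rfl
        smul_mem' := fun c a ha s hs => by
          rw [lp.coeFn_smul, Pi.smul_apply, ha s hs, smul_zero] }
    have hle : absEigenspaceGE (atomicLength hsymm) t ≤ V := by
      refine iSup₂_le fun r hr v hv s hs => ?_
      have hr' : t ≤ r := hr
      rw [mem_sqEigenspace_atomicLength hsymm (ht.le.trans hr')] at hv
      by_contra h0
      refine hs (hfin.mem_toFinset.2 ?_)
      change t ≤ dist s.1.1 s.1.2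
      rw [hv s h0]
      exact hr'
    exact fun v hv => hle hv
  have hcard : Module.rank ℂ (absEigenspaceGE (atomicLength hsymm) t) ≤ F.card := by
    let f : absEigenspaceGE (atomicLength hsymm) t →ₗ[ℂ] (F → ℂ) :=
      { toFun := fun v s => v.1 s.1
        map_add' := fun v w => rfl
        map_smul' := fun c v => rfl }
    have hf : Function.Injective f := by
      rw [injective_iff_map_eq_zero]
      intro v hv
      ext s
      by_cases hs : s ∈ F
      · exact congrFun hv ⟨s, hs⟩
      · exact hsupp v v.2 s hs
    refine (LinearMap.rank_le_of_injective f hf).trans_eq ?_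
    rw [rank_fun', Fintype.card_coe]
  have hi : i + 1 ≤ F.card := by
    have := hrank.trans_le hcard
    exact_mod_cast this
  have hle : (i + 1 : ℝ) * t ^ q ≤ ∑' s : S, dist s.1.1 s.1.2 ^ q := by
    calc (i + 1 : ℝ) * t ^ q ≤ F.card * t ^ q := by
          gcongr
          exact_mod_cast hi
      _ = ∑ s ∈ F, t ^ q := by rw [Finset.sum_const, nsmul_eq_mul]
      _ ≤ ∑ s ∈ F, dist s.1.1 s.1.2 ^ q := by
          refine Finset.sum_le_sum fun s hs => ?_
          have : t ≤ dist s.1.1 s.1.2 := hfin.mem_toFinset.1 hs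
          gcongr
      _ ≤ _ := hsum.sum_le_tsum _ fun s _ => by positivity
  rw [one_div, Real.le_rpow_inv_iff_of_pos ht.le (by positivity) hq, le_div_iff₀ (by positivity)]
  linarith

end AtomicGeometry

/-! ### Vanishing of the Dixmier trace -/

/-- Since `p/q > 1`, the series of `μ_i^p` converges; division by `log N` sends its partial sums to
`0`, where every `φ` gives the ordinary limit. -/
theorem dixmierTraceAbsPow_eq_zero {H : Type*} [NormedAddCommGroup H] [InnerProductSpace ℂ H]
    (φ : DixmierLimit) {T : H →L[ℂ] H} {C q : ℝ} (hC : 0 ≤ C) (hq : 0 < q)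
    (h : ∀ i : ℕ, absEigenvalue T i ≤ (C / (i + 1)) ^ (1 / q)) {p : ℝ≥0} (hp : q < p) :
    dixmierTraceAbsPow φ T p = 0 := by
  let a : ℕ → ℝ := fun i => C ^ ((p : ℝ) / q) * (1 / ((i : ℝ) + 1) ^ ((p : ℝ) / q))
  have ha : Summable a := by
    have h1 : Summable fun i : ℕ => 1 / (i : ℝ) ^ ((p : ℝ) / q) :=
      Real.summable_one_div_nat_rpow.2 (by rwa [lt_div_iff₀ hq, one_mul])
    have h2 := ((summable_nat_add_iff 1).2 h1).mul_left (C ^ ((p : ℝ) / q))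
    simpa [a] using h2
  have hterm : ∀ i, (if absEigenvalue T i = 0 then 0 else absEigenvalue T i ^ (p : ℝ)) ≤ a i := by
    intro i
    split_ifs
    · positivity
    · calc absEigenvalue T i ^ (p : ℝ) ≤ ((C / (i + 1)) ^ (1 / q)) ^ (p : ℝ) := by
            have := absEigenvalue_nonneg T i
            gcongr
            exact h i
        _ = a i := by
            rw [← Real.rpow_mul (by positivity), Real.div_rpow hC (by positivity)]
            simp only [a]
            rw [one_div_mul_eq_div, mul_one_div]
  have hterm0 : ∀ i, 0 ≤ (if absEigenvalue T i = 0 then 0 else absEigenvalue T i ^ (p : ℝ)) := by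
    intro i
    have := absEigenvalue_nonneg T i
    split_ifs <;> positivity
  have ha0 : ∀ i, 0 ≤ a i := fun i => (hterm0 i).trans (hterm i)
  have hlim : Tendsto (dixmierSeq T p) atTop (𝓝 0) := by
    have h1 : Tendsto (fun n : ℕ => (∑' i, a i) / Real.log ((n : ℝ) + 2)) atTop (𝓝 0) :=
      tendsto_const_nhds.div_atTop (Real.tendsto_log_atTop.comp
        (tendsto_atTop_add_const_right _ _ tendsto_natCast_atTop_atTop))
    have hlog : ∀ n : ℕ, 0 ≤ Real.log ((n : ℝ) + 2) := fun n =>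
      Real.log_nonneg (by linarith [n.cast_nonneg (α := ℝ)])
    refine squeeze_zero (fun n => div_nonneg (Finset.sum_nonneg fun i _ => hterm0 i) (hlog n))
      (fun n => ?_) h1
    refine div_le_div_of_nonneg_right ?_ (hlog n)
    exact (Finset.sum_le_sum fun i _ => hterm i).trans (ha.sum_le_tsum _ fun i _ => ha0 i)
  have hbdd : ∃ C : ℝ, ∀ m n, dist (dixmierSeq T p m) (dixmierSeq T p n) ≤ C := by
    obtain ⟨C, hC⟩ := Metric.isBounded_iff.1 (Metric.isBounded_range_of_tendsto _ hlim)
    exact ⟨C, fun m n => hC (mem_range_self m) (mem_range_self n)⟩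
  rw [dixmierTraceAbsPow, dif_pos hbdd, φ.eq_of_tendsto _ 0 hlim, ENNReal.ofReal_zero]

/-! ### The dimension of spectral geometries on manifolds -/

theorem SpectralGeometry.natCast_le_dim {X : Type*} [MetricSpace X] [CompactSpace X]
    {M : SpectralGeometry X} {φ : DixmierLimit} {n : ℕ}
    (h : ∀ p : ℝ≥0, p < n → dixmierTraceAbsPow φ M.ds p = ⊤) : (n : ℝ≥0∞) ≤ M.dim φ := by
  refine le_of_forall_lt fun a ha => ?_
  obtain ⟨b, hab, hbn⟩ := exists_between ha
  lift b to ℝ≥0 using (hbn.trans (ENNReal.natCast_lt_top n)).ne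
  exact hab.trans_le (le_iSup₂_of_le b (h b (by exact_mod_cast hbn)) le_rfl)

theorem SpectralGeometry.natCast_le_dimInf {X : Type*} [MetricSpace X] [CompactSpace X]
    {M : SpectralGeometry X} {φ : DixmierLimit} {n : ℕ}
    (h : ∀ p : ℝ≥0, p < n → dixmierTraceAbsPow φ M.ds p = ⊤) : (n : ℝ≥0∞) ≤ M.dimInf φ := by
  refine le_iInf₂ fun p hp => ?_
  by_contra! hlt
  have h1 : dixmierTraceAbsPow φ M.ds p = 0 := hp
  rw [h p (by exact_mod_cast hlt)] at h1
  exact ENNReal.top_ne_zero h1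

theorem SpectralGeometry.dim_le_natCast {X : Type*} [MetricSpace X] [CompactSpace X]
    {M : SpectralGeometry X} {φ : DixmierLimit} {n : ℕ}
    (h : ∀ p : ℝ≥0, n < p → dixmierTraceAbsPow φ M.ds p = 0) : M.dim φ ≤ n := by
  refine iSup₂_le fun p hp => ?_
  by_contra! hlt
  have h1 : dixmierTraceAbsPow φ M.ds p = ⊤ := hp
  rw [h p (by exact_mod_cast hlt)] at h1
  exact ENNReal.top_ne_zero h1.symm

theorem SpectralGeometry.dimInf_le_natCast {X : Type*} [MetricSpace X] [CompactSpace X]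
    {M : SpectralGeometry X} {φ : DixmierLimit} {n : ℕ}
    (h : ∀ p : ℝ≥0, n < p → dixmierTraceAbsPow φ M.ds p = 0) : M.dimInf φ ≤ n := by
  refine le_of_forall_gt fun a ha => ?_
  obtain ⟨b, hnb, hba⟩ := exists_between ha
  lift b to ℝ≥0 using (hba.trans_le le_top).ne
  exact (iInf₂_le_of_le b (h b (by exact_mod_cast hnb)) le_rfl).trans_lt hba

theorem LocallyBilipschitz.exists_dixmierTraceAbsPow_eq_top {n : ℕ} {X : Type*} [MetricSpace X]
    [CompactSpace X] [Nonempty X] (hX : LocallyBilipschitz n X) :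
    ∃ D : ℝ≥0, ∀ M : SpectralGeometry X, D < M.localDensity → ∀ (φ : DixmierLimit) (p : ℝ≥0),
      p < n → dixmierTraceAbsPow φ M.ds p = ⊤ := by
  -- For `n = 0` there is no `p` below `n`, and any `D` will do.
  rcases n.eq_zero_or_pos with rfl | hn
  · exact ⟨0, fun M _ φ p hp => absurd hp (by simp)⟩
  obtain ⟨D, hD⟩ := SpectralGeometry.exists_forall_le_absEigenvalue hn hX
  refine ⟨D, fun M hM φ p hp => ?_⟩
  obtain ⟨c, hc, m₀, h⟩ := hD M hM
  exact dixmierTraceAbsPow_eq_top φ hc h hp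

theorem LocallyBilipschitz.exists_dixmierTraceAbsPow_eq_zero {n : ℕ} {X : Type*} [MetricSpace X]
    [CompactSpace X] (hX : LocallyBilipschitz n X) :
    ∃ M : SpectralGeometry X, M.localDensity = ⊤ ∧ ∀ (φ : DixmierLimit) (p : ℝ≥0),
      n < p → dixmierTraceAbsPow φ M.ds p = 0 := by
  obtain ⟨S, hsymm, hne, hsum, hdens⟩ := hX.exists_localDensity_eq_top
  have hS : Tendsto (fun s : S => dist s.1.1 s.1.2) cofinite (𝓝 0) := by
    have hn : (0 : ℝ) < n + 1 := by positivity
    have h1 := (hsum (n + 1) (by linarith)).tendsto_cofinite_zero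
    have h2 := h1.rpow_const (p := ((n : ℝ) + 1)⁻¹) (.inr (by positivity))
    rw [Real.zero_rpow (by positivity)] at h2
    exact h2.congr fun s => Real.rpow_rpow_inv dist_nonneg hn.ne'
  refine ⟨atomicGeometry hsymm hS hne, top_le_iff.1 ?_, fun φ p hp => ?_⟩
  · rw [← hdens]
    exact localDensity_mono (subset_support_atomicGeometry hsymm hS hne)
  · have hp' : (n : ℝ) < p := by exact_mod_cast hp
    -- The midpoint lies strictly between `n` and `p`: summability over `S` needs `q > n`, vanishing
    -- of the trace needs `q < p`. The geometry itself does not depend on `p`.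
    have hq : 0 < ((n : ℝ) + p) / 2 := by linarith [n.cast_nonneg (α := ℝ)]
    exact dixmierTraceAbsPow_eq_zero φ (tsum_nonneg fun s => by positivity) hq
      (absEigenvalue_atomicLength_le hsymm hq (hsum _ (by linarith))) (by linarith)

end

theorem mainTheorem10 (n : ℕ) (X : Type*) [MetricSpace X] [CompactSpace X] [Nonempty X]
    [ChartedSpace (EuclideanSpace ℝ (Fin n)) X] [IsManifold (𝓡 n) ∞ X]
    [Bundle.RiemannianBundle (fun x : X => TangentSpace (𝓡 n) x)]
    [IsContMDiffRiemannianBundle (𝓡 n) ∞ (EuclideanSpace ℝ (Fin n))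
      (fun x : X => TangentSpace (𝓡 n) x)]
    [IsRiemannianManifold (𝓡 n) X] :
    (∃ M : SpectralGeometry X, M.localDensity = (⊤ : ℝ≥0∞) ∧
      ∀ φ : DixmierLimit, M.dim φ = (n : ℝ≥0∞) ∧ M.dimInf φ = (n : ℝ≥0∞)) ∧
    ∀ φ : DixmierLimit, spectralDim φ X = (n : ℝ≥0∞) := by
  have hX := locallyBilipschitz_of_isRiemannianManifold n X
  obtain ⟨D, hD⟩ := hX.exists_dixmierTraceAbsPow_eq_top
  obtain ⟨M, hM, hM0⟩ := hX.exists_dixmierTraceAbsPow_eq_zero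
  have hMtop := hD M (by rw [hM]; exact ENNReal.coe_lt_top)
  have hdim : ∀ φ, M.dim φ = n := fun φ => le_antisymm
    (SpectralGeometry.dim_le_natCast (hM0 φ)) (SpectralGeometry.natCast_le_dim (hMtop φ))
  refine ⟨⟨M, hM, fun φ => ⟨hdim φ, le_antisymm (SpectralGeometry.dimInf_le_natCast (hM0 φ))
    (SpectralGeometry.natCast_le_dimInf (hMtop φ))⟩⟩, fun φ => le_antisymm ?_ ?_⟩
  -- The geometry `M` has infinite density, so it belongs to every set of the filter and its
  -- dimension bounds the lower limit from above.
  · refine liminf_le_of_frequently_le' (Frequently.mono (p := fun M' => M' = M) ?_ ?_)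
    · intro h
      obtain ⟨U, hU, hUM⟩ := mem_comap.1 h
      refine hUM (?_ : M ∈ SpectralGeometry.localDensity ⁻¹' U) rfl
      rw [mem_preimage, hM]
      exact mem_of_mem_nhds hU
    · rintro _ rfl
      exact (hdim φ).le
  · refine le_liminf_of_le (by isBoundedDefault) ?_
    filter_upwards [preimage_mem_comap (Ioi_mem_nhds (ENNReal.coe_lt_top (r := D)))] with M' hM'
    exact SpectralGeometry.natCast_le_dim (hD M' hM' φ)
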